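/- Let $S^1=\mathbb R/2\pi\mathbb Z$, let $M\ge 2^9$ be a real number, and define on the cylinder $S^1\times\mathbb R$ the maps $$T(x,y)=(2x \bmod 2\pi,\,8y),\quad s(x,y)=(x,\,My-(M-1)\sin x),\quad \sigma(x,y)=(x-2\pi y,\,y),\quad W=s\circ\sigma .$$ Let $g(z)=3z \bmod 2\pi$ on $S^1$, let $I_1=[0,\pi/2]$ and $I_2=[\pi,3\pi/2]$ in $S^1$, and let $C=\{z\in S^1 : g^n(z)\in I_1\cup I_2 \text{ for all } n\ge 0\}$. Let $A=S^1\times[-2,2]$. For $(x,y,z)\in S^1\times\mathbb R\times(I_1\cup I_2)$ put $$F(x,y,z)=\begin{cases}(T(x,y),g(z)) & \text{if } z\in I_1,\\ (W(x,y),g(z)) & \text{if } z\in I_2,\end{cases}$$ with $F$ extended arbitrarily elsewhere, and let $$\mathbb B=\bigcap_{n\ge 0}F^{-n}\bigl(A\times(I_1\cup I_2)\bigr)$$ be the set of points whose forward orbits stay in $A\times (I_1\cup I_2)$. Then: 1. $\mathbb B$ is compact and $F(\mathbb B)=\mathbb B$. 2. $C$ is a Cantor set, and the projection of $\mathbb B$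 to the third factor is $C$. For each $z\in C$ there is exactly one sequence $\alpha=(\alpha_n)_{n\ge0}$ of 1's and 2's with $g^n(z)\in I_{\alpha_n}$ for all $n$, and for each such sequence $\alpha$ there is a $z\in C$ with $\bigcap_{n\ge 0}g^{-n}(I_{\alpha_n})=\{z\}$. 3. For each $z\in C$ with associated sequence $\alpha$, the slice $B_z=\bigcap_{n\ge0}F^{-n}(A\times I_{\alpha_n})$ is a nonempty connected component of $\mathbb B$, and its projection to the third factor is $\{z\}$. 4. There is a dense $G_\delta$ subset $G$ of $C$ such that $B_z$ is a pseudocircle for every $z\in G$. Here a continuum is a nonempty compact connected subset of a metric space; it is hereditarily indecomposable if none of its subcontinua (itself included) is the union of two of its own proper subcontinua; it is circlelike (respectively arclike) if for each $\varepsilon>0$ it admits a continuous map to $S^1$ (respectively to $[0,1]$) all of whose fibres have diameter less than $\varepsilon$; a pseudocircle is a hereditarily indecomposable, circlelike continuum that is not arclike. -/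

import Mathlib

open Set

namespace SkewPseudocircle

/-! ### Continua -/

section Continua

variable {E : Type*} [MetricSpace E]

/-- A continuum: a (nonempty) compact connected subset of a metric space. -/
def IsContinuum (K : Set E) : Prop := IsCompact K ∧ IsConnected K

/-- A continuum is decomposable if it is the union of two of its proper subcontinua. -/
def IsDecomposable (K : Set E) : Prop :=
  ∃ P Q : Set E, IsContinuum P ∧ IsContinuum Q ∧ P ⊂ K ∧ Q ⊂ K ∧ P ∪ Q = K

/-- Every subcontinuum (the whole continuum included) is indecomposable. -/
def IsHereditarilyIndecomposable (K : Set E) : Prop :=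
  IsContinuum K ∧ ∀ L : Set E, IsContinuum L → L ⊆ K → ¬ IsDecomposable L

/-- The circle `ℝ / 2πℤ`. -/
abbrev S1 : Type := Real.Angle

/-- Circlelike: for each `ε > 0` there is a continuous map to the circle all of whose
fibres have diameter less than `ε`. -/
def IsCirclelike (K : Set E) : Prop :=
  ∀ ε : ℝ, 0 < ε → ∃ f : E → S1, ContinuousOn f K ∧
    ∀ z : S1, Metric.diam (K ∩ f ⁻¹' {z}) < ε

/-- Arclike (chainable): the same with the unit interval in place of the circle.  Points, arcs
and the pseudoarc are arclike. -/
def IsArclike (K : Set E) : Prop :=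
  ∀ ε : ℝ, 0 < ε → ∃ f : E → ℝ, ContinuousOn f K ∧ MapsTo f K (Icc 0 1) ∧
    ∀ t : ℝ, Metric.diam (K ∩ f ⁻¹' {t}) < ε

/-- A pseudocircle: a hereditarily indecomposable, circlelike continuum that is not arclike.
(The last clause separates pseudocircles from one-point continua and from pseudoarcs.) -/
def IsPseudocircle (K : Set E) : Prop :=
  IsContinuum K ∧ IsHereditarilyIndecomposable K ∧ IsCirclelike K ∧ ¬ IsArclike K

end Continua

/-- A Cantor set: a set homeomorphic to the ternary Cantor set. -/
def IsCantorSet {E : Type*} [TopologicalSpace E] (K : Set E) : Prop :=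
  Nonempty (K ≃ₜ cantorSet)

/-- `K` is a connected component of the subspace `S`. -/
def IsComponentOf {E : Type*} [TopologicalSpace E] (K S : Set E) : Prop :=
  ∃ p ∈ S, K = connectedComponentIn S p

/-! ### The maps -/

/-- The "two" map `T(x, y) = (2x mod 2π, 8y)` on the cylinder. -/
noncomputable def mapT (p : S1 × ℝ) : S1 × ℝ := ((2 : ℕ) • p.1, 8 * p.2)

/-- `s(x, y) = (x, My - (M - 1) sin x)`. -/
noncomputable def mapS (M : ℝ) (p : S1 × ℝ) : S1 × ℝ :=
  (p.1, M * p.2 - (M - 1) * Real.Angle.sin p.1)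

/-- The shear `σ(x, y) = (x - 2πy, y)`. -/
noncomputable def shear (p : S1 × ℝ) : S1 × ℝ :=
  (p.1 - ((2 * Real.pi * p.2 : ℝ) : S1), p.2)

/-- The "wiggle" map `W = s ∘ σ`. -/
noncomputable def mapW (M : ℝ) : S1 × ℝ → S1 × ℝ := mapS M ∘ shear

/-- `g(z) = 3z mod 2π`. -/
noncomputable def mapG (z : S1) : S1 := (3 : ℕ) • z

/-- The arc `I₁ = [0, π/2]`. -/
def I₁ : Set S1 := (fun t : ℝ => (t : S1)) '' Icc 0 (Real.pi / 2)

/-- The arc `I₂ = [π, 3π/2]`. -/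
def I₂ : Set S1 := (fun t : ℝ => (t : S1)) '' Icc Real.pi (3 * Real.pi / 2)

/-- The two arcs as a family; the symbols `0, 1 : Fin 2` stand for `1, 2`. -/
def arc : Fin 2 → Set S1 := ![I₁, I₂]

/-- `C`: the points whose `g`-orbit stays in `I₁ ∪ I₂`. -/
def cantorC : Set S1 := {z | ∀ n : ℕ, mapG^[n] z ∈ I₁ ∪ I₂}

open Classical in
/-- The itinerary of a point of `C` (with respect to the disjoint arcs `I₁`, `I₂`). -/
noncomputable def itinerary (z : S1) (n : ℕ) : Fin 2 := if mapG^[n] z ∈ I₁ then 0 else 1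

/-- The annulus `A = S¹ × [-2, 2]`. -/
def annulus : Set (S1 × ℝ) := univ ×ˢ Icc (-2) 2

/-- `F` is the skew product on `S¹ × ℝ × (I₁ ∪ I₂)`; nothing is required of it elsewhere. -/
def IsSkewProduct (M : ℝ) (F : (S1 × ℝ) × S1 → (S1 × ℝ) × S1) : Prop :=
  (∀ p : S1 × ℝ, ∀ z ∈ I₁, F (p, z) = (mapT p, mapG z)) ∧
  (∀ p : S1 × ℝ, ∀ z ∈ I₂, F (p, z) = (mapW M p, mapG z))

/-- The invariant set: the points whose forward orbit stays in `A × (I₁ ∪ I₂)`.  Only values of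
`F` on `S¹ × ℝ × (I₁ ∪ I₂)` matter. -/
def invariantSet (F : (S1 × ℝ) × S1 → (S1 × ℝ) × S1) : Set ((S1 × ℝ) × S1) :=
  ⋂ n : ℕ, F^[n] ⁻¹' (annulus ×ˢ (I₁ ∪ I₂))

/-- The slice `B_z = ⋂ₙ F⁻ⁿ(A × I_{αₙ})`, where `α` is the itinerary of `z`. -/
noncomputable def slice (F : (S1 × ℝ) × S1 → (S1 × ℝ) × S1) (z : S1) : Set ((S1 × ℝ) × S1) :=
  ⋂ n : ℕ, F^[n] ⁻¹' (annulus ×ˢ arc (itinerary z n))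

end SkewPseudocircle

open SkewPseudocircle

/-!
The slice over `z` is a copy of `limitSet M α`, where `α` is the itinerary of `z`: the set of points
of the cylinder that never leave the annulus under the composition, along `α`, of the fibre maps
`T` (symbol `0`) and `W` (symbol `1`).  Both maps lift to homeomorphisms of the plane and pull the
annulus back into itself, so the limit set is a decreasing intersection of the compact connected
sets `level M α n`.  The tripling map codes `C` by all symbol sequences (`coding`), which gives the
Cantor set and makes the slices the components.

The generic sequences are those with `HasLongRuns α N` for all `N`: behind some prefix of length
`l` there is a run of `T`s and then a run of `W`s, both long compared with `l`.  Such sequences form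
a dense `Gδ` set.  For them the limit set is hereditarily indecomposable, for the following reason.
* The run of `T`s makes the first coordinate behind the run determine the initial point up to a
  small error, even if the coordinate is known only up to a bounded error (`dist_le_of_zero_run`).
* In the inverse of the lift of `W`, the fixed points `(± π/2, ± 1)` of `W` become points that move
  by `± 2π` in each step, which is the fastest possible drift (`IsWiggleOrbit.abs_sub_le`), and
  whole fibres close to them drift along (`IsWiggleOrbit.drift`).  Take a path of orbits of `W`
  whose initial coordinates run from `p` to `q`, and look at it about `|q - p| / 4π` steps later.
  There it still crosses the middle between `p` and `q`, so it crosses a fibre that drifts to the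
  one side and then a fibre that drifts to the other side.  Hence the initial coordinate comes close
  to `q` and afterwards comes back close to `p`, with an error independent of `|q - p|`
  (`exists_crooked_indices`).
* If a continuum were the union of proper subcontinua `P` and `Q`, choose `p ∈ P` off `Q` and
  `q ∈ Q` off `P`.  A discrete path from `p` to `q` through `P` first and `Q` afterwards cannot
  come close to `q` and later close to `p` (`exists_dist_lt_of_hasLongRuns`).

The rescaled first coordinate behind a run of `T`s also shows circlelikeness.  A limit set is never
arclike: on an arclike set the angle has a real lift up to a small error, but the limit set
contains fine closed discrete paths that wind once around the cylinder.
-/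

namespace SkewPseudocircle

/-! ### Discrete paths and backward orbits of the wiggle map -/

/-- A real sequence with small steps meets every level it passes, up to one step. -/
lemma exists_index_crossing {u : ℕ → ℝ} {δ c : ℝ} {s t : ℕ} (hst : s ≤ t)
    (hstep : ∀ n, |u (n + 1) - u n| ≤ δ) (hs : u s ≤ c) (ht : c ≤ u t) :
    ∃ n, s ≤ n ∧ n ≤ t ∧ c ≤ u n ∧ u n ≤ c + δ := by
  have hδ : 0 ≤ δ := (abs_nonneg _).trans (hstep 0)
  induction t, hst using Nat.le_induction with
  | base => exact ⟨s, le_rfl, le_rfl, ht, by linarith⟩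
  | succ t hst ih =>
    rcases le_or_gt c (u t) with h | h
    · obtain ⟨n, h1, h2, h3⟩ := ih h
      exact ⟨n, h1, h2.trans t.le_succ, h3⟩
    · have := (abs_le.1 (hstep t)).2
      exact ⟨t + 1, hst.trans t.le_succ, le_rfl, ht, by linarith⟩

/-- `(X j, Y j)`, `0 ≤ j ≤ m`, is an orbit of length `m` of the lift of `W` to `ℝ × ℝ` that stays
in the strip `|y| ≤ 2`.  The recursion is written for the inverse of the lift, which expresses
step `j` through step `j + 1`. -/
def IsWiggleOrbit (M : ℝ) (m : ℕ) (X Y : ℕ → ℝ) : Prop :=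
  (∀ j ≤ m, |Y j| ≤ 2) ∧
    ∀ j < m, Y j = (Y (j + 1) + (M - 1) * Real.sin (X (j + 1))) / M ∧
      X j = X (j + 1) + 2 * Real.pi * Y j

namespace IsWiggleOrbit

variable {M : ℝ} {m : ℕ} {X Y : ℕ → ℝ}

lemma mono (h : IsWiggleOrbit M m X Y) {i : ℕ} (hi : i ≤ m) : IsWiggleOrbit M i X Y :=
  ⟨fun j hj => h.1 j (hj.trans hi), fun j hj => h.2 j (hj.trans_le hi)⟩

lemma tail (h : IsWiggleOrbit M (m + 1) X Y) :
    IsWiggleOrbit M m (fun j => X (j + 1)) (fun j => Y (j + 1)) :=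
  ⟨fun j hj => h.1 (j + 1) (by omega), fun j hj => h.2 (j + 1) (by omega)⟩

/-- The lift of `W` commutes with `(x, y) ↦ (-x, -y)`. -/
lemma neg (h : IsWiggleOrbit M m X Y) :
    IsWiggleOrbit M m (fun j => -X j) (fun j => -Y j) := by
  refine ⟨fun j hj => by simpa using h.1 j hj, fun j hj => ?_⟩
  obtain ⟨h1, h2⟩ := h.2 j hj
  constructor
  · simp only [Real.sin_neg]
    rw [h1]; ring
  · beta_reduce
    rw [h2]; ring

/-- Each step moves `x` by `2π` at most, up to errors whose sum stays bounded: the height `|y|`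
approaches `[-1, 1]` geometrically. -/
lemma abs_sub_le (hM : 2 ^ 9 ≤ M) (h : IsWiggleOrbit M m X Y) :
    |X 0 - X m| ≤ 2 * Real.pi * m + 2 * Real.pi := by
  have hM0 : (0 : ℝ) < M := lt_of_lt_of_le (by norm_num) hM
  have hpi := Real.pi_pos
  suffices H : |Y 0| ≤ 1 + (1 / 2) ^ m ∧
      |X 0 - X m| ≤ 2 * Real.pi * m + 2 * Real.pi * (1 - (1 / 2) ^ m) by
    have : (0 : ℝ) < (1 / 2) ^ m := by positivity
    nlinarith [H.2]
  induction m generalizing X Y with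
  | zero => have := h.1 0 le_rfl; norm_num; linarith
  | succ m ih =>
    obtain ⟨i1, i2⟩ := ih h.tail
    simp only [zero_add] at i1 i2
    obtain ⟨h1, h2⟩ := h.2 0 m.succ_pos
    simp only [zero_add] at h1 h2
    have hpos : (0 : ℝ) < (1 / 2) ^ m := by positivity
    have hY : |Y 0| ≤ 1 + (1 / 2) ^ (m + 1) := by
      have hnum : |Y 1 + (M - 1) * Real.sin (X 1)| ≤ (1 + (1 / 2) ^ m) + (M - 1) := by
        refine (abs_add_le _ _).trans (add_le_add i1 ?_)
        rw [abs_mul, abs_of_pos (by linarith)]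
        exact mul_le_of_le_one_right (by linarith) (Real.abs_sin_le_one _)
      rw [h1, abs_div, abs_of_pos hM0, div_le_iff₀ hM0, pow_succ]
      nlinarith
    refine ⟨hY, ?_⟩
    have : X 0 - X (m + 1) = (X 1 - X (m + 1)) + 2 * Real.pi * Y 0 := by rw [h2]; ring
    rw [this]
    refine (abs_add_le _ _).trans ?_
    rw [abs_mul, abs_of_pos (show 0 < 2 * Real.pi by linarith)]
    have h3 := mul_le_mul_of_nonneg_left hY (show 0 ≤ 2 * Real.pi by linarith)
    push_cast
    rw [pow_succ] at h3 ⊢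
    linarith

/-- Near the fixed point `(π/2, 1)` of `W` the inverse of `W` has a trapping region, entered in one
step from every point of the strip over `π/2 + [0.1, 0.11]`.  In the cover such orbits drift by
`2π` in each step.  With `x = π/2 + e` and `y = 1 + η` the region is `0 ≤ e ≤ 0.11`,
`-e ≤ η ≤ 0`. -/
lemma drift (hM : 2 ^ 9 ≤ M) (h : IsWiggleOrbit M (m + 1) X Y) {k : ℤ} {e : ℝ}
    (he : e ∈ Icc (0.1 : ℝ) 0.11)
    (hX : X (m + 1) = Real.pi / 2 + 2 * Real.pi * k + e) :
    ∃ e' ∈ Icc (0 : ℝ) 0.11, ∃ η ∈ Icc (-e') 0, Y 0 = 1 + η ∧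
      X 0 = Real.pi / 2 + 2 * Real.pi * (k + (m + 1)) + e' := by
  have hM0 : (0 : ℝ) < M := lt_of_lt_of_le (by norm_num) hM
  have hpi := Real.pi_pos
  have hpi2 := Real.pi_lt_d2
  have hsin : ∀ (z : ℤ) (e : ℝ),
      Real.sin (Real.pi / 2 + 2 * Real.pi * (z : ℝ) + e) = Real.cos e := by
    intro z e
    rw [show Real.pi / 2 + 2 * Real.pi * (z : ℝ) + e = (e + Real.pi / 2) + z * (2 * Real.pi) by
      ring, Real.sin_add_int_mul_two_pi, Real.sin_add_pi_div_two]
  have hdiv : ∀ t : ℝ, 0 ≤ t → t / M ≤ t / 512 := fun t ht =>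
    div_le_div_of_nonneg_left ht (by norm_num) (by linarith)
  induction m generalizing X Y with
  | zero =>
    obtain ⟨h1, h2⟩ := h.2 0 (by omega)
    simp only [zero_add] at h1 h2 hX
    rw [hX, hsin] at h1
    obtain ⟨he1, he2⟩ := he
    have hy := abs_le.1 (h.1 1 le_rfl)
    have hc1 := Real.one_sub_sq_div_two_le_cos (x := e)
    have hc2 : Real.cos e ≤ 1 - 0.0049 := by
      have := (abs_le.1 (Real.cos_bound (x := e) (by rw [abs_of_nonneg] <;> linarith))).2
      rw [abs_of_nonneg (by linarith)] at this
      have h4 : e ^ 4 ≤ 0.11 ^ 4 := pow_le_pow_left₀ (by linarith) he2 4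
      norm_num at h4
      nlinarith
    have hη : Y 0 = 1 + (Y 1 - 1 - (M - 1) * (1 - Real.cos e)) / M := by
      rw [h1]; field_simp; ring
    set η := (Y 1 - 1 - (M - 1) * (1 - Real.cos e)) / M with hηdef
    -- the constant `2 ^ 9` matters here: `(M - 1) (1 - cos 0.1) ≥ 1` outweighs `Y 1 - 1 ≤ 1`
    have hη0 : η ≤ 0 := div_nonpos_of_nonpos_of_nonneg (by nlinarith) hM0.le
    have hη1 : -(3 / 512 + e ^ 2 / 2) ≤ η := by
      have : η = (Y 1 - 1) / M - (1 - Real.cos e) + (1 - Real.cos e) / M := by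
        rw [hηdef]; field_simp; ring
      have a1 := hdiv 3 (by norm_num)
      have a2 : -(3 / M) ≤ (Y 1 - 1) / M := by
        rw [← neg_div]; gcongr; linarith
      have a3 : 0 ≤ (1 - Real.cos e) / M := div_nonneg (by linarith [Real.cos_le_one e]) hM0.le
      rw [this]; linarith
    have hη2 : 2 * Real.pi * η ≤ 0 := by nlinarith
    have hη3 : 2 * Real.pi * (-η) ≤ 6.3 * (-η) := by nlinarith
    refine ⟨e + 2 * Real.pi * η, ⟨by nlinarith, by linarith⟩, η, ⟨by nlinarith, hη0⟩, hη, ?_⟩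
    rw [h2, hX, hη]; push_cast; ring
  | succ m ih =>
    obtain ⟨e', ⟨he1, he2⟩, η', ⟨hη1, hη2⟩, hY1, hX1⟩ := ih h.tail hX
    simp only [zero_add] at hY1 hX1
    obtain ⟨h1, h2⟩ := h.2 0 (by omega)
    simp only [zero_add] at h1 h2
    have hX1' : X 1 = Real.pi / 2 + 2 * Real.pi * ((k + (m + 1) : ℤ) : ℝ) + e' := by
      rw [hX1]; push_cast; ring
    rw [hX1', hsin, hY1] at h1
    have hc1 := Real.one_sub_sq_div_two_le_cos (x := e')
    have hc2 := Real.cos_le_one e'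
    have hη : Y 0 = 1 + (η' - (M - 1) * (1 - Real.cos e')) / M := by
      rw [h1]; field_simp; ring
    set η := (η' - (M - 1) * (1 - Real.cos e')) / M with hηdef
    have hη0 : η ≤ 0 := div_nonpos_of_nonpos_of_nonneg (by nlinarith) hM0.le
    have hηl : -(0.07 * e') ≤ η := by
      have : η = η' / M - (1 - Real.cos e') + (1 - Real.cos e') / M := by
        rw [hηdef]; field_simp; ring
      have a1 := hdiv e' he1
      have a2 : -(e' / M) ≤ η' / M := by rw [← neg_div]; gcongr
      have a3 : 0 ≤ (1 - Real.cos e') / M := div_nonneg (by linarith) hM0.le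
      rw [this]; nlinarith
    have hη3 : 2 * Real.pi * (-η) ≤ 6.3 * (-η) := by nlinarith
    have hη4 : 2 * Real.pi * η ≤ 0 := by nlinarith
    refine ⟨e' + 2 * Real.pi * η, ⟨by nlinarith, by linarith⟩, η, ⟨by nlinarith, hη0⟩, hη, ?_⟩
    rw [h2, hX1, hη]; push_cast; ring

end IsWiggleOrbit

/-- The case `X 0 0 ≤ X N 0` of `exists_crooked_indices`. -/
lemma exists_crooked_indices_of_le {M : ℝ} (hM : 2 ^ 9 ≤ M) {m N : ℕ} {X Y : ℕ → ℕ → ℝ} {Λ : ℝ}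
    (horb : ∀ n, IsWiggleOrbit M m (X n) (Y n))
    (hstep : ∀ n, ∀ j ≤ m, |X (n + 1) j - X n j| ≤ 0.01) (hΛ : 0.01 ≤ Λ)
    (hm : 2 * Λ ≤ 4 * Real.pi * m) (hle : X 0 0 ≤ X N 0) :
    ∃ n₁ n₂, n₁ ≤ n₂ ∧ n₂ ≤ N ∧ ∃ j₁ j₂ : ℤ, |X n₁ 0 - (X N 0 + j₁ * Λ)| ≤ 64 ∧
      |X n₂ 0 - (X 0 0 + j₂ * Λ)| ≤ 64 := by
  have hpi := Real.pi_gt_d2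
  have hpi2 := Real.pi_lt_d2
  have hpi0 := Real.pi_pos
  set p := X 0 0 with hp
  set q := X N 0 with hq
  rcases lt_or_ge (q - p) (20 * Real.pi) with hD | hD
  · refine ⟨0, 0, le_rfl, N.zero_le, 0, 0, ?_, ?_⟩
    · rw [← hp, abs_le]; push_cast; constructor <;> linarith
    · rw [← hp]; norm_num
  rcases lt_or_ge (2 * Λ) (q - p) with hD2 | hD2
  · -- the path is longer than two periods: a translate of `q`, then one of `p`, are met on the way
    have hf1 := Int.floor_le ((q - p) / Λ)
    have hf2 := Int.lt_floor_add_one ((q - p) / Λ)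
    set j := ⌊(q - p) / Λ⌋
    have hΛ0 : 0 < Λ := by linarith
    rw [le_div_iff₀ hΛ0] at hf1
    rw [div_lt_iff₀ hΛ0] at hf2
    obtain ⟨n₁, -, h1, h2, h3⟩ := exists_index_crossing (u := fun n => X n 0) (c := q - j * Λ)
      N.zero_le (fun n => hstep n 0 m.zero_le) (by linarith) (by
        have : (0 : ℝ) ≤ j := by
          have : 0 ≤ j := Int.floor_nonneg.2 (div_nonneg (by linarith) hΛ0.le)
          exact_mod_cast this
        nlinarith)
    obtain ⟨n₂, h4, h5, h6, h7⟩ := exists_index_crossing (u := fun n => X n 0) (c := p + 2 * Λ)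
      h1 (fun n => hstep n 0 m.zero_le) (by linarith) (by linarith)
    refine ⟨n₁, n₂, h4, h5, -j, 2, ?_, ?_⟩ <;> push_cast <;> rw [abs_le] <;>
      constructor <;> linarith
  -- otherwise cross, at the level where the drift is about half of `q - p`, a fibre drifting to
  -- the right and then one drifting to the left; the level is lowered by `4` to leave room for
  -- both fibres between the two ends of the path
  have hf1 := Nat.floor_le (show 0 ≤ (q - p) / (4 * Real.pi) by
    apply div_nonneg <;> linarith)
  have hf2 := Nat.lt_floor_add_one ((q - p) / (4 * Real.pi))
  have hr5 : 5 ≤ ⌊(q - p) / (4 * Real.pi)⌋₊ := by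
    apply Nat.le_floor
    rw [le_div_iff₀ (by linarith)]; push_cast; linarith
  obtain ⟨i, hi⟩ := Nat.exists_eq_add_of_le hr5
  rw [hi] at hf1 hf2
  rw [le_div_iff₀ (by linarith)] at hf1
  rw [div_lt_iff₀ (by linarith)] at hf2
  push_cast at hf1 hf2
  have him : i + 1 ≤ m := by
    have : ((i + 1 : ℕ) : ℝ) ≤ m := by push_cast; nlinarith
    exact_mod_cast this
  have ha := (abs_le.1 (((horb 0).mono him).abs_sub_le hM)).1
  have hb := (abs_le.1 (((horb N).mono him).abs_sub_le hM)).2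
  push_cast at ha hb
  have hk1 := Int.floor_le ((p + q) / 2 / (2 * Real.pi))
  have hk2 := Int.lt_floor_add_one ((p + q) / 2 / (2 * Real.pi))
  set k := ⌊(p + q) / 2 / (2 * Real.pi)⌋
  rw [le_div_iff₀ (by linarith)] at hk1
  rw [div_lt_iff₀ (by linarith)] at hk2
  obtain ⟨n₁, -, h1, h2, h3⟩ := exists_index_crossing (u := fun n => X n (i + 1))
      (c := Real.pi / 2 + 2 * Real.pi * k + 0.1)
      N.zero_le (fun n => hstep n _ him) (by linarith) (by linarith)
  obtain ⟨n₂, h4, h5, h6, h7⟩ := exists_index_crossing (u := fun n => X n (i + 1))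
      (c := - Real.pi / 2 + 2 * Real.pi * (k + 1) - 0.11)
      h1 (fun n => hstep n _ him) (by linarith) (by linarith)
  obtain ⟨e, ⟨he1, he2⟩, η, -, -, hX1⟩ := ((horb n₁).mono him).drift hM (k := k)
    (e := X n₁ (i + 1) - (Real.pi / 2 + 2 * Real.pi * k)) ⟨by linarith, by linarith⟩ (by ring)
  obtain ⟨e', ⟨he1', he2'⟩, η', -, -, hX2⟩ := (((horb n₂).mono him).neg).drift hM (k := -(k + 1))
    (e := -X n₂ (i + 1) - (Real.pi / 2 + 2 * Real.pi * (-(k + 1)))) ⟨by linarith, by linarith⟩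
    (by push_cast; ring)
  push_cast at hX2
  refine ⟨n₁, n₂, h4, h5, 0, 0, ?_, ?_⟩ <;> push_cast <;> rw [abs_le] <;>
      constructor <;> linarith

/-- Crookedness of the wiggle map.  Let `X n`, `n ≤ N`, be a discrete path of orbits of the lift of
`W`.  If the orbits are long enough, then the path of their initial points comes near its end point
and later comes back near its starting point, both up to translation by the period `Λ`.  The error
bound `64` does not depend on the length of the path. -/
lemma exists_crooked_indices {M : ℝ} (hM : 2 ^ 9 ≤ M) {m : ℕ} (N : ℕ) {X Y : ℕ → ℕ → ℝ} {Λ : ℝ}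
    (horb : ∀ n, IsWiggleOrbit M m (X n) (Y n))
    (hstep : ∀ n, ∀ j ≤ m, |X (n + 1) j - X n j| ≤ 0.01) (hΛ : 0.01 ≤ Λ)
    (hm : 2 * Λ ≤ 4 * Real.pi * m) :
    ∃ n₁ n₂, n₁ ≤ n₂ ∧ n₂ ≤ N ∧ ∃ j₁ j₂ : ℤ, |X n₁ 0 - (X N 0 + j₁ * Λ)| ≤ 64 ∧
      |X n₂ 0 - (X 0 0 + j₂ * Λ)| ≤ 64 := by
  rcases le_total (X 0 0) (X N 0) with h | h
  · exact exists_crooked_indices_of_le hM horb hstep hΛ hm h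
  · obtain ⟨n₁, n₂, h1, h2, j₁, j₂, h3, h4⟩ := exists_crooked_indices_of_le hM
      (X := fun n j => -X n j) (Y := fun n j => -Y n j) (N := N) (fun n => (horb n).neg)
      (fun n j hj => by
        rw [show -X (n + 1) j - -X n j = -(X (n + 1) j - X n j) by ring, abs_neg]
        exact hstep n j hj) hΛ hm (neg_le_neg h)
    refine ⟨n₁, n₂, h1, h2, -j₁, -j₂, ?_, ?_⟩
    · rw [← abs_neg]; convert h3 using 2; push_cast; ring
    · rw [← abs_neg]; convert h4 using 2; push_cast; ring

/-! ### Chains in connected sets -/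

/-- `c` is a discrete path in `s` from `x` to `y` (reached at time `N`) with steps shorter than
`δ`. -/
def IsChain {E : Type*} [PseudoMetricSpace E] (s : Set E) (δ : ℝ) (x y : E) (N : ℕ)
    (c : ℕ → E) : Prop :=
  c 0 = x ∧ c N = y ∧ (∀ n, c n ∈ s) ∧ ∀ n, dist (c n) (c (n + 1)) < δ

lemma exists_isChain {E : Type*} [PseudoMetricSpace E] {s : Set E} (hs : IsPreconnected s)
    {δ : ℝ} (hδ : 0 < δ) {x y : E} (hx : x ∈ s) (hy : y ∈ s) :
    ∃ N c, IsChain s δ x y N c := by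
  refine hs.induction₂' (fun x y => ∃ N c, IsChain s δ x y N c) ?_ ?_ hx hy
  · intro x hx
    filter_upwards [self_mem_nhdsWithin,
      mem_nhdsWithin_of_mem_nhds (Metric.ball_mem_nhds x hδ)] with y hy hyd
    have : ∀ u ∈ s, ∀ v ∈ s, dist u v < δ → ∃ N c, IsChain s δ u v N c := by
      intro u hu v hv huv
      refine ⟨1, fun n => if n = 0 then u else v, by simp, by simp, ?_, ?_⟩
      · intro n; beta_reduce; split_ifs <;> assumption
      · intro n; rcases n with _ | n <;> simp [huv, hδ]
    exact ⟨this x hx y hy (by rwa [dist_comm]), this y hy x hx hyd⟩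
  · rintro x y z - - - ⟨N, c, h1, h2, h3, h4⟩ ⟨N', c', h1', h2', h3', h4'⟩
    refine ⟨N + N', fun n => if n ≤ N then c n else c' (n - N), by simpa using h1, ?_, ?_, ?_⟩
    · rcases N'.eq_zero_or_pos with rfl | h
      · simp [h2, ← h1', h2']
      · simp [h.ne', h2']
    · intro n; beta_reduce; split_ifs
      exacts [h3 _, h3' _]
    · intro n; beta_reduce
      rcases lt_trichotomy n N with h | rfl | h
      · rw [if_pos h.le, if_pos (by omega)]; exact h4 n
      · rw [if_pos le_rfl, if_neg (by omega), h2, ← h1', show n + 1 - n = 0 + 1 by omega]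
        exact h4' 0
      · rw [if_neg (by omega), if_neg (by omega), show n + 1 - N = n - N + 1 by omega]
        exact h4' _

/-! ### The circle -/

lemma norm_angle_eq (θ : S1) : ‖θ‖ = |θ.toReal| := by
  have h := (AddCircle.norm_coe_eq_abs_iff (2 * Real.pi) (x := θ.toReal)
    (by positivity)).2 (by
      rw [abs_of_pos Real.two_pi_pos]; linarith [Real.Angle.abs_toReal_le_pi θ])
  rw [← h]
  conv_lhs => rw [← Real.Angle.coe_toReal θ]
  rfl

lemma norm_angle_coe_le (x : ℝ) : ‖(x : S1)‖ ≤ |x| := by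
  rw [norm_angle_eq]
  rcases le_or_gt |x| Real.pi with h | h
  · rcases (neg_le_of_abs_le h).eq_or_lt with h' | h'
    · rw [← h']; simp [abs_of_pos Real.pi_pos]
    · rw [Real.Angle.toReal_coe_eq_self_iff.2 ⟨h', le_of_abs_le h⟩]
  · exact (Real.Angle.abs_toReal_le_pi _).trans h.le

lemma dist_angle_coe_le (x y : ℝ) : dist (x : S1) (y : S1) ≤ |x - y| := by
  rw [dist_eq_norm, ← Real.Angle.coe_sub]
  exact norm_angle_coe_le _

lemma angle_coe_add_mul (x : ℝ) (k : ℤ) : ((x + 2 * Real.pi * k : ℝ) : S1) = x := by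
  rw [Real.Angle.angle_eq_iff_two_pi_dvd_sub]
  exact ⟨k, by ring⟩

instance : CompactSpace S1 := by
  refine ⟨?_⟩
  have : (univ : Set S1) = (fun t : ℝ => (t : S1)) '' Icc (-Real.pi) Real.pi := by
    refine (eq_univ_of_forall fun θ => ?_).symm
    exact ⟨θ.toReal, ⟨(Real.Angle.neg_pi_lt_toReal θ).le, Real.Angle.toReal_le_pi θ⟩, by simp⟩
  rw [this]
  exact isCompact_Icc.image Real.Angle.continuous_coe

/-! ### The fibre maps and their lifts to the plane -/

/-- The fibre map over the arc with symbol `a`. -/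
noncomputable def fib (M : ℝ) (a : Fin 2) : S1 × ℝ → S1 × ℝ := if a = 0 then mapT else mapW M

/-- The lift of `fib M a` to `ℝ × ℝ`. -/
noncomputable def fibL (M : ℝ) (a : Fin 2) (p : ℝ × ℝ) : ℝ × ℝ :=
  if a = 0 then (2 * p.1, 8 * p.2)
  else (p.1 - 2 * Real.pi * p.2,
    M * p.2 - (M - 1) * Real.sin (p.1 - 2 * Real.pi * p.2))

/-- The inverse of `fibL M a`. -/
noncomputable def invL (M : ℝ) (a : Fin 2) (p : ℝ × ℝ) : ℝ × ℝ :=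
  if a = 0 then (p.1 / 2, p.2 / 8)
  else (p.1 + 2 * Real.pi * ((p.2 + (M - 1) * Real.sin p.1) / M),
    (p.2 + (M - 1) * Real.sin p.1) / M)

/-- The universal covering of the cylinder. -/
noncomputable def cov (p : ℝ × ℝ) : S1 × ℝ := ((p.1 : S1), p.2)

/-- `orb M α n` is the composition of the fibre maps along the first `n` symbols of `α`. -/
noncomputable def orb (M : ℝ) (α : ℕ → Fin 2) : ℕ → S1 × ℝ → S1 × ℝ
  | 0, p => p
  | n + 1, p => fib M (α n) (orb M α n p)

/-- The lift of `orb M α n`. -/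
noncomputable def orbL (M : ℝ) (α : ℕ → Fin 2) : ℕ → ℝ × ℝ → ℝ × ℝ
  | 0, p => p
  | n + 1, p => fibL M (α n) (orbL M α n p)

/-- The inverse of `orbL M α n`, which applies the inverse fibre maps in the opposite order. -/
noncomputable def back (M : ℝ) (α : ℕ → Fin 2) : ℕ → ℝ × ℝ → ℝ × ℝ
  | 0, p => p
  | n + 1, p => back M α n (invL M (α n) p)

/-- The number of symbols `0`, which stand for `T`, among the first `n` symbols of `α`. The degree
of `orb M α n` on the circle is `2 ^ twos α n`. -/
def twos (α : ℕ → Fin 2) : ℕ → ℕ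
  | 0 => 0
  | n + 1 => twos α n + if α n = 0 then 1 else 0

lemma twos_le (α : ℕ → Fin 2) (n : ℕ) : twos α n ≤ n := by
  induction n with
  | zero => exact le_rfl
  | succ n ih => rw [twos]; split_ifs <;> omega

section Lifts

variable {M : ℝ} {α : ℕ → Fin 2}

lemma fib_cov (a : Fin 2) (p : ℝ × ℝ) : fib M a (cov p) = cov (fibL M a p) := by
  by_cases h : a = 0
  · simp [fib, fibL, h, cov, mapT, two_mul, two_nsmul]
  · simp only [fib, fibL, h, if_false, cov, mapW, mapS, shear, Function.comp_apply,
      ← Real.Angle.coe_sub, Real.Angle.sin_coe]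

lemma orb_cov (n : ℕ) (p : ℝ × ℝ) : orb M α n (cov p) = cov (orbL M α n p) := by
  induction n with
  | zero => rfl
  | succ n ih => rw [orb, ih, fib_cov, orbL]

lemma fibL_invL (hM : M ≠ 0) (a : Fin 2) (p : ℝ × ℝ) : fibL M a (invL M a p) = p := by
  by_cases h : a = 0
  · ext <;> simp [fibL, invL, h] <;> ring
  · simp only [fibL, invL, h, if_false, add_sub_cancel_right]
    ext
    · rfl
    · field_simp; ring

lemma invL_fibL (hM : M ≠ 0) (a : Fin 2) (p : ℝ × ℝ) : invL M a (fibL M a p) = p := by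
  by_cases h : a = 0
  · ext <;> simp [fibL, invL, h]
  · have : (M * p.2 - (M - 1) * Real.sin (p.1 - 2 * Real.pi * p.2) +
      (M - 1) * Real.sin (p.1 - 2 * Real.pi * p.2)) / M = p.2 := by field_simp; ring
    simp only [fibL, invL, h, if_false, this]
    ext
    · simp
    · rfl

lemma orbL_back (hM : M ≠ 0) (n : ℕ) (p : ℝ × ℝ) : orbL M α n (back M α n p) = p := by
  induction n generalizing p with
  | zero => rfl
  | succ n ih => rw [orbL, back, ih, fibL_invL hM]

lemma back_orbL (hM : M ≠ 0) (n : ℕ) (p : ℝ × ℝ) : back M α n (orbL M α n p) = p := by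
  induction n with
  | zero => rfl
  | succ n ih => rw [orbL, back, invL_fibL hM, ih]

lemma dist_cov_le (p q : ℝ × ℝ) : dist (cov p) (cov q) ≤ dist p q := by
  rw [Prod.dist_eq, Prod.dist_eq]
  exact max_le_max (dist_angle_coe_le _ _) le_rfl

lemma continuous_cov : Continuous cov :=
  (Real.Angle.continuous_coe.comp continuous_fst).prodMk continuous_snd

lemma exists_cov_eq (p : S1 × ℝ) : ∃ q, cov q = p := ⟨(p.1.toReal, p.2), by simp [cov]⟩

lemma abs_sin_sub_sin_le (x y : ℝ) : |Real.sin x - Real.sin y| ≤ |x - y| := by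
  have := Real.lipschitzWith_sin.dist_le_mul x y
  simpa [Real.dist_eq] using this

lemma dist_invL_le (hM : 1 ≤ M) (a : Fin 2) (p q : ℝ × ℝ) :
    dist (invL M a p) (invL M a q) ≤ 8 * dist p q := by
  have h1 : |p.1 - q.1| ≤ dist p q := le_max_left (dist p.1 q.1) _
  have h2 : |p.2 - q.2| ≤ dist p q := le_max_right (dist p.1 q.1) _
  have hd : 0 ≤ dist p q := dist_nonneg
  have hpi := Real.pi_lt_d2
  rw [Prod.dist_eq (x := invL M a p)]
  by_cases h : a = 0
  · simp only [invL, h, if_true, Real.dist_eq, ← sub_div, abs_div]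
    rw [abs_of_pos (by norm_num : (0 : ℝ) < 2), abs_of_pos (by norm_num : (0 : ℝ) < 8)]
    apply max_le <;> linarith
  · have hM0 : 0 < M := by linarith
    have hy : |(p.2 + (M - 1) * Real.sin p.1) / M - (q.2 + (M - 1) * Real.sin q.1) / M| ≤
        dist p q := by
      rw [← sub_div, abs_div, abs_of_pos hM0, div_le_iff₀ hM0,
        show p.2 + (M - 1) * Real.sin p.1 - (q.2 + (M - 1) * Real.sin q.1) =
          (p.2 - q.2) + (M - 1) * (Real.sin p.1 - Real.sin q.1) by ring]
      refine (abs_add_le _ _).trans ?_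
      rw [abs_mul, abs_of_nonneg (by linarith : 0 ≤ M - 1)]
      have := mul_le_mul_of_nonneg_left ((abs_sin_sub_sin_le p.1 q.1).trans h1)
        (by linarith : 0 ≤ M - 1)
      linarith
    simp only [invL, h, if_false, Real.dist_eq]
    apply max_le
    · set u := (p.2 + (M - 1) * Real.sin p.1) / M
      set v := (q.2 + (M - 1) * Real.sin q.1) / M
      rw [show p.1 + 2 * Real.pi * u - (q.1 + 2 * Real.pi * v) =
        (p.1 - q.1) + 2 * Real.pi * (u - v) by ring]
      refine (abs_add_le _ _).trans ?_
      rw [abs_mul, abs_of_pos Real.two_pi_pos]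
      have := mul_le_mul_of_nonneg_left hy Real.two_pi_pos.le
      nlinarith
    · linarith

lemma dist_back_le (hM : 1 ≤ M) (n : ℕ) (p q : ℝ × ℝ) :
    dist (back M α n p) (back M α n q) ≤ 8 ^ n * dist p q := by
  induction n generalizing p q with
  | zero => simp [back]
  | succ n ih =>
    rw [back, back]
    refine (ih _ _).trans ?_
    rw [pow_succ, mul_assoc]
    exact mul_le_mul_of_nonneg_left (dist_invL_le hM _ _ _) (by positivity)

lemma dist_fibL_le (hM : 1 ≤ M) (a : Fin 2) (p q : ℝ × ℝ) :
    dist (fibL M a p) (fibL M a q) ≤ 9 * M * dist p q := by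
  have h1 : |p.1 - q.1| ≤ dist p q := le_max_left (dist p.1 q.1) _
  have h2 : |p.2 - q.2| ≤ dist p q := le_max_right (dist p.1 q.1) _
  have hd : 0 ≤ dist p q := dist_nonneg
  have hMd : dist p q ≤ M * dist p q := le_mul_of_one_le_left hd hM
  have hpi := Real.pi_lt_d2
  rw [Prod.dist_eq (x := fibL M a p)]
  by_cases h : a = 0
  · simp only [fibL, h, if_true, Real.dist_eq, ← mul_sub, abs_mul]
    rw [abs_of_pos (by norm_num : (0 : ℝ) < 2), abs_of_pos (by norm_num : (0 : ℝ) < 8)]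
    apply max_le <;> linarith
  · simp only [fibL, h, if_false, Real.dist_eq]
    have hx : |p.1 - 2 * Real.pi * p.2 - (q.1 - 2 * Real.pi * q.2)| ≤ 8 * dist p q := by
      rw [show p.1 - 2 * Real.pi * p.2 - (q.1 - 2 * Real.pi * q.2) =
        (p.1 - q.1) + -(2 * Real.pi * (p.2 - q.2)) by ring]
      refine (abs_add_le _ _).trans ?_
      rw [abs_neg, abs_mul, abs_of_pos Real.two_pi_pos]
      have := mul_le_mul_of_nonneg_left h2 Real.two_pi_pos.le
      nlinarith
    apply max_le
    · linarith
    · set u := p.1 - 2 * Real.pi * p.2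
      set v := q.1 - 2 * Real.pi * q.2
      rw [show M * p.2 - (M - 1) * Real.sin u - (M * q.2 - (M - 1) * Real.sin v) =
        M * (p.2 - q.2) + -((M - 1) * (Real.sin u - Real.sin v)) by ring]
      refine (abs_add_le _ _).trans ?_
      rw [abs_neg, abs_mul, abs_mul, abs_of_nonneg (by linarith : 0 ≤ M - 1),
        abs_of_pos (by linarith : 0 < M)]
      have a1 := mul_le_mul_of_nonneg_left ((abs_sin_sub_sin_le u v).trans hx)
        (by linarith : 0 ≤ M - 1)
      have a2 := mul_le_mul_of_nonneg_left h2 (by linarith : 0 ≤ M)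
      nlinarith

lemma dist_orbL_le (hM : 1 ≤ M) (n : ℕ) (p q : ℝ × ℝ) :
    dist (orbL M α n p) (orbL M α n q) ≤ (9 * M) ^ n * dist p q := by
  induction n with
  | zero => simp [orbL]
  | succ n ih =>
    rw [orbL, orbL]
    refine (dist_fibL_le hM _ _ _).trans ?_
    rw [pow_succ', mul_assoc (9 * M)]
    exact mul_le_mul_of_nonneg_left ih (by linarith)

/-- The deck transformation `x ↦ x + 2πj` becomes `x ↦ x + 2π 2ᵗ j` at level `n`. -/
lemma orbL_shift (n : ℕ) (p : ℝ × ℝ) (j : ℤ) :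
    orbL M α n (p.1 + 2 * Real.pi * j, p.2) =
      ((orbL M α n p).1 + 2 * Real.pi * 2 ^ twos α n * j, (orbL M α n p).2) := by
  induction n with
  | zero => simp [orbL, twos]
  | succ n ih =>
    rw [orbL, ih, orbL, twos]
    set q := orbL M α n p
    by_cases h : α n = 0
    · ext
      · simp only [fibL, h, if_true]; ring
      · simp only [fibL, h, if_true]
    · have e : q.1 + 2 * Real.pi * 2 ^ twos α n * j - 2 * Real.pi * q.2 =
          (q.1 - 2 * Real.pi * q.2) + ((2 ^ twos α n * j : ℤ) : ℝ) * (2 * Real.pi) := by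
        push_cast; ring
      simp only [fibL, h, if_false, e, Real.sin_add_int_mul_two_pi]
      ext
      · push_cast; ring
      · rfl

end Lifts

/-! ### Limit sets of nonautonomous sequences of fibre maps -/

/-- A decreasing intersection of compact connected sets is connected. -/
lemma isConnected_iInter_of_antitone {E : Type*} [TopologicalSpace E] [T2Space E] {K : ℕ → Set E}
    (hK : Antitone K) (hc : ∀ n, IsCompact (K n)) (hconn : ∀ n, IsConnected (K n)) :
    IsConnected (⋂ n, K n) := by
  have hcl : IsClosed (⋂ n, K n) := isClosed_iInter fun n => (hc n).isClosed
  have hcomp : IsCompact (⋂ n, K n) := (hc 0).of_isClosed_subset hcl (iInter_subset _ 0)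
  refine ⟨IsCompact.nonempty_iInter_of_sequence_nonempty_isCompact_isClosed K
    (fun n => hK n.le_succ) (fun n => (hconn n).nonempty) (hc 0) fun n => (hc n).isClosed, ?_⟩
  rw [isPreconnected_iff_subset_of_fully_disjoint_closed hcl]
  intro u v hu hv huv hdisj
  obtain ⟨U, V, hU, hV, hsU, hsV, hUV⟩ := SeparatedNhds.of_isCompact_isCompact
    (hcomp.inter_right hu) (hcomp.inter_right hv)
    (hdisj.mono inter_subset_right inter_subset_right)
  obtain ⟨n, hn⟩ := exists_subset_nhds_of_isCompact (hK.directed_ge) hc (U := U ∪ V) (by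
    intro x hx
    rcases huv hx with h | h
    · exact (hU.union hV).mem_nhds (Or.inl (hsU ⟨hx, h⟩))
    · exact (hU.union hV).mem_nhds (Or.inr (hsV ⟨hx, h⟩)))
  rcases (isPreconnected_iff_subset_of_disjoint.1 (hconn n).isPreconnected) U V hU hV hn
    (by rw [hUV.inter_eq, inter_empty]) with h | h
  · left; intro x hx
    rcases huv hx with h' | h'
    · exact h'
    · exact (hUV.le_bot ⟨h (mem_iInter.1 hx n), hsV ⟨hx, h'⟩⟩).elim
  · right; intro x hx
    rcases huv hx with h' | h'
    · exact (hUV.le_bot ⟨hsU ⟨hx, h'⟩, h (mem_iInter.1 hx n)⟩).elim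
    · exact h'

lemma mem_annulus {p : S1 × ℝ} : p ∈ annulus ↔ |p.2| ≤ 2 := by
  simp [annulus, abs_le]

lemma isCompact_annulus : IsCompact annulus := isCompact_univ.prod isCompact_Icc

/-- The points that the first `n` fibre maps along `α` carry into the annulus. -/
def level (M : ℝ) (α : ℕ → Fin 2) (n : ℕ) : Set (S1 × ℝ) := orb M α n ⁻¹' annulus

/-- The points that never leave the annulus under the fibre maps along `α`. -/
def limitSet (M : ℝ) (α : ℕ → Fin 2) : Set (S1 × ℝ) := ⋂ n, level M α n

section Level

variable {M : ℝ} {α : ℕ → Fin 2}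

/-- Both fibre maps expand away from the annulus. -/
lemma abs_snd_le_of_fib (hM : 2 ^ 9 ≤ M) (a : Fin 2) {p : S1 × ℝ} (h : |(fib M a p).2| ≤ 2) :
    |p.2| ≤ 2 := by
  by_cases ha : a = 0
  · simp only [fib, ha, if_true, mapT] at h
    rw [abs_le] at h ⊢
    constructor <;> linarith
  · simp only [fib, ha, if_false, mapW, mapS, shear, Function.comp_apply] at h
    set θ := p.1 - ((2 * Real.pi * p.2 : ℝ) : S1)
    have hs : |(M - 1) * θ.sin| ≤ M - 1 := by
      have : |θ.sin| ≤ 1 := by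
        rw [← Real.Angle.coe_toReal θ, Real.Angle.sin_coe]; exact Real.abs_sin_le_one _
      rw [abs_mul, abs_of_pos (by linarith)]
      exact mul_le_of_le_one_right (by linarith) this
    rw [abs_le] at h hs ⊢
    constructor <;> nlinarith

lemma continuous_fib (a : Fin 2) : Continuous (fib M a) := by
  by_cases ha : a = 0
  · simp only [fib, ha, if_true]
    unfold mapT
    fun_prop
  · simp only [fib, ha, if_false]
    have h1 : Continuous shear := by
      unfold shear
      refine Continuous.prodMk ?_ continuous_snd
      exact continuous_fst.sub (Real.Angle.continuous_coe.comp (by fun_prop))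
    have h2 : Continuous (mapS M) := by
      unfold mapS
      refine Continuous.prodMk continuous_fst ?_
      exact (continuous_const.mul continuous_snd).sub
        (continuous_const.mul (Real.Angle.continuous_sin.comp continuous_fst))
    exact h2.comp h1

lemma continuous_orb (n : ℕ) : Continuous (orb M α n) := by
  induction n with
  | zero => exact continuous_id
  | succ n ih => exact (continuous_fib _).comp ih

lemma continuous_back (hM : 1 ≤ M) (n : ℕ) : Continuous (back M α n) :=
  (LipschitzWith.of_dist_le_mul (K := 8 ^ n) (fun p q => by
    simpa using dist_back_le hM n p q)).continuous

lemma level_antitone (hM : 2 ^ 9 ≤ M) : Antitone (level M α) :=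
  antitone_nat_of_succ_le fun n p hp => by
    rw [level, mem_preimage, mem_annulus] at hp ⊢
    exact abs_snd_le_of_fib hM _ hp

lemma isCompact_level (hM : 2 ^ 9 ≤ M) (n : ℕ) : IsCompact (level M α n) :=
  isCompact_annulus.of_isClosed_subset (isCompact_annulus.isClosed.preimage (continuous_orb n))
    (level_antitone hM n.zero_le)

/-- The strip `ℝ × [-2, 2]` covering the annulus. -/
def strip : Set (ℝ × ℝ) := univ ×ˢ Icc (-2) 2

lemma mem_strip {p : ℝ × ℝ} : p ∈ strip ↔ |p.2| ≤ 2 := by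
  simp [strip, abs_le]

lemma isConnected_back_image_strip (hM : 1 ≤ M) (n : ℕ) :
    IsConnected (back M α n '' strip) := by
  refine IsConnected.image ?_ _ (continuous_back hM n).continuousOn
  exact isConnected_univ.prod (isConnected_Icc (by norm_num))

lemma cov_mem_level {n : ℕ} {p : ℝ × ℝ} : cov p ∈ level M α n ↔ |(orbL M α n p).2| ≤ 2 := by
  rw [level, mem_preimage, orb_cov, mem_annulus]; rfl

lemma mem_back_image_strip (hM : 1 ≤ M) {n : ℕ} {p : ℝ × ℝ} :
    p ∈ back M α n '' strip ↔ cov p ∈ level M α n := by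
  have hM' : M ≠ 0 := by linarith
  rw [cov_mem_level]
  constructor
  · rintro ⟨q, hq, rfl⟩
    rwa [orbL_back hM', ← mem_strip]
  · intro h
    exact ⟨_, mem_strip.2 h, back_orbL hM' n p⟩

lemma isConnected_level (hM : 1 ≤ M) (n : ℕ) : IsConnected (level M α n) := by
  have : level M α n = cov '' (back M α n '' strip) := by
    ext p
    constructor
    · intro hp
      obtain ⟨q, rfl⟩ := exists_cov_eq p
      exact ⟨q, (mem_back_image_strip hM).2 hp, rfl⟩
    · rintro ⟨q, hq, rfl⟩
      exact (mem_back_image_strip hM).1 hq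
  rw [this]
  exact (isConnected_back_image_strip hM n).image _ continuous_cov.continuousOn

lemma isConnected_limitSet (hM : 2 ^ 9 ≤ M) : IsConnected (limitSet M α) :=
  isConnected_iInter_of_antitone (level_antitone hM) (isCompact_level hM)
    fun n => isConnected_level (by linarith) n

lemma isCompact_limitSet (hM : 2 ^ 9 ≤ M) : IsCompact (limitSet M α) :=
  (isCompact_level hM 0).of_isClosed_subset
    (isClosed_iInter fun n => (isCompact_level hM n).isClosed) (iInter_subset _ 0)

lemma cov_mem_limitSet {p : ℝ × ℝ} : cov p ∈ limitSet M α ↔ ∀ n, |(orbL M α n p).2| ≤ 2 := by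
  simp [limitSet, cov_mem_level]

end Level

/-! ### Hereditary indecomposability -/

/-- `α` contains, at some position `l`, a run of `0`s followed by a run of `1`s, both long compared
with what precedes them.  The bound on `2 ^ k` turns the error `64` of `exists_crooked_indices` into
an error `1 / (N + 1)` in the limit set; the run of `1`s has to be long compared with the period at
level `l + k`, which is at most `2π 2 ^ (l + k)`. -/
def HasLongRuns (α : ℕ → Fin 2) (N : ℕ) : Prop :=
  ∃ l k : ℕ, (∀ i < k, α (l + i) = 0) ∧ (∀ i < 2 ^ (l + k), α (l + k + i) = 1) ∧
    64 * 8 ^ l * (N + 1) < 2 ^ k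

section HI

variable {M : ℝ} {α : ℕ → Fin 2}

lemma orbL_zero_run {l k : ℕ} (h : ∀ i < k, α (l + i) = 0) (p : ℝ × ℝ) :
    orbL M α (l + k) p = (2 ^ k * (orbL M α l p).1, 8 ^ k * (orbL M α l p).2) := by
  induction k with
  | zero => simp
  | succ k ih =>
    rw [← add_assoc, orbL, ih fun i hi => h i (by omega), fibL, if_pos (h k k.lt_succ_self)]
    ext <;> simp only [pow_succ] <;> ring

/-- After a run of `k` symbols `0`, the first coordinate alone determines the initial point up to an
error of order `2 ^ (-k)`, since such a run squeezes the relevant part of the annulus to a thin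
neighbourhood of its core circle. -/
lemma dist_le_of_zero_run (hM : 1 ≤ M) {l k : ℕ} (h : ∀ i < k, α (l + i) = 0) {p q : ℝ × ℝ}
    (hp : cov p ∈ limitSet M α) (hq : cov q ∈ limitSet M α)
    (hpq : |(orbL M α (l + k) p).1 - (orbL M α (l + k) q).1| ≤ 64) :
    dist p q ≤ 8 ^ l * (64 / 2 ^ k) := by
  have hM' : M ≠ 0 := by linarith
  rw [← back_orbL (α := α) hM' l p, ← back_orbL (α := α) hM' l q]
  refine (dist_back_le hM _ _ _).trans (mul_le_mul_of_nonneg_left ?_ (by positivity))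
  have h2 := cov_mem_limitSet.1 hp (l + k)
  have h3 := cov_mem_limitSet.1 hq (l + k)
  rw [orbL_zero_run h] at h2 h3 hpq
  rw [orbL_zero_run h] at hpq
  simp only [← mul_sub, abs_mul, abs_of_pos (show (0 : ℝ) < 2 ^ k by positivity),
    abs_of_pos (show (0 : ℝ) < 8 ^ k by positivity)] at h2 h3 hpq
  have h28 : (2 : ℝ) ^ k ≤ 8 ^ k := pow_le_pow_left₀ (by norm_num) (by norm_num) k
  have hk : (0 : ℝ) < 2 ^ k := by positivity
  rw [Prod.dist_eq, Real.dist_eq, Real.dist_eq]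
  apply max_le
  · rw [le_div_iff₀ hk]; linarith
  · rw [le_div_iff₀ hk]
    have := abs_sub (orbL M α l p).2 (orbL M α l q).2
    have h4 := mul_le_mul_of_nonneg_right h28 (abs_nonneg (orbL M α l p).2)
    have h5 := mul_le_mul_of_nonneg_right h28 (abs_nonneg (orbL M α l q).2)
    nlinarith

lemma isWiggleOrbit_of_one_run (hM : 1 ≤ M) {s m : ℕ} (h : ∀ i < m, α (s + i) = 1) {p : ℝ × ℝ}
    (hp : cov p ∈ limitSet M α) :
    IsWiggleOrbit M m (fun j => (orbL M α (s + j) p).1) (fun j => (orbL M α (s + j) p).2) := by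
  refine ⟨fun j _ => cov_mem_limitSet.1 hp _, fun j hj => ?_⟩
  have h1 : orbL M α (s + j) p = invL M 1 (orbL M α (s + (j + 1)) p) := by
    rw [← add_assoc, orbL, h j hj, invL_fibL (by linarith)]
  have h2 := congrArg Prod.snd h1
  have h3 := congrArg Prod.fst h1
  simp only [invL, one_ne_zero, if_false] at h2 h3
  exact ⟨h2, by beta_reduce; rw [h2, h3]⟩

lemma exists_lift_chain {δ : ℝ} (c : ℕ → S1 × ℝ) (hc : ∀ n, dist (c n) (c (n + 1)) < δ) :
    ∃ z : ℕ → ℝ × ℝ, (∀ n, cov (z n) = c n) ∧ ∀ n, dist (z n) (z (n + 1)) < δ := by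
  obtain ⟨z₀, hz₀⟩ := exists_cov_eq (c 0)
  let z : ℕ → ℝ × ℝ := fun n => Nat.rec z₀
    (fun n w => (w.1 + ((c (n + 1)).1 - (c n).1).toReal, (c (n + 1)).2)) n
  have hz : ∀ n, z (n + 1) = ((z n).1 + ((c (n + 1)).1 - (c n).1).toReal, (c (n + 1)).2) :=
    fun n => rfl
  have hcov : ∀ n, cov (z n) = c n := by
    intro n
    induction n with
    | zero => exact hz₀
    | succ n ih =>
      rw [hz, cov]
      have : ((z n).1 : S1) = (c n).1 := congrArg Prod.fst ih
      ext
      · simp [this]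
      · rfl
  refine ⟨z, hcov, fun n => ?_⟩
  refine lt_of_eq_of_lt ?_ (hc n)
  have h2 : (z n).2 = (c n).2 := congrArg Prod.snd (hcov n)
  rw [hz, Prod.dist_eq, Prod.dist_eq, h2]
  congr 1
  rw [dist_comm (c n).1, dist_eq_norm (c (n + 1)).1, norm_angle_eq, Real.dist_eq, ← abs_neg]
  congr 1; ring

/-- Two intersecting connected subsets of the limit set cannot each contain a point far from the
other one: a discrete path from `p` to `q` that runs first through `P` and then through `Q` comes
close to `q` and later comes back close to `p`. -/
lemma exists_dist_lt_of_hasLongRuns (hM : 2 ^ 9 ≤ M) {N : ℕ} (hα : HasLongRuns α N)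
    {P Q : Set (S1 × ℝ)} (hP : IsPreconnected P) (hQ : IsPreconnected Q)
    (hPK : P ⊆ limitSet M α) (hQK : Q ⊆ limitSet M α) (hPQ : (P ∩ Q).Nonempty)
    {p q : S1 × ℝ} (hp : p ∈ P) (hq : q ∈ Q) :
    (∃ x ∈ P, dist x q < 1 / (N + 1)) ∨ ∃ x ∈ Q, dist x p < 1 / (N + 1) := by
  obtain ⟨l, k, h0, h1, hk⟩ := hα
  obtain ⟨r, hrP, hrQ⟩ := hPQ
  have hM1 : 1 ≤ M := by linarith
  set m := 2 ^ (l + k) with hm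
  have hpow : (0 : ℝ) < (9 * M) ^ (l + k + m) := by positivity
  -- the steps of the path are so small that they stay below `0.01` at all levels up to `l + k + m`
  set δ : ℝ := 0.01 / (9 * M) ^ (l + k + m) with hδ
  obtain ⟨N₁, c₁, a1, a2, a3, a4⟩ := exists_isChain hP (δ := δ) (by positivity) hp hrP
  obtain ⟨N₂, c₂, b1, b2, b3, b4⟩ := exists_isChain hQ (δ := δ) (by positivity) hrQ hq
  set c : ℕ → S1 × ℝ := fun n => if n ≤ N₁ then c₁ n else c₂ (n - N₁) with hc
  have hcP : ∀ n ≤ N₁, c n ∈ P := fun n hn => by simp only [hc, if_pos hn]; exact a3 n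
  have hcQ' : ∀ n, N₁ ≤ n → c n = c₂ (n - N₁) := fun n hn => by
    rcases hn.eq_or_lt with rfl | hn
    · simp [hc, a2, b1]
    · simp only [hc, if_neg (not_le.2 hn)]
  have hcQ : ∀ n, N₁ ≤ n → c n ∈ Q := fun n hn => by rw [hcQ' n hn]; exact b3 _
  have hcK : ∀ n, c n ∈ limitSet M α := fun n =>
    (le_total n N₁).elim (fun h => hPK (hcP n h)) fun h => hQK (hcQ n h)
  have hstep : ∀ n, dist (c n) (c (n + 1)) < δ := by
    intro n
    rcases lt_or_ge n N₁ with h | h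
    · simp only [hc, if_pos h.le, if_pos (show n + 1 ≤ N₁ from h)]; exact a4 n
    · rw [hcQ' n h, hcQ' (n + 1) (by omega), Nat.sub_add_comm h]; exact b4 _
  obtain ⟨z, hz, hzd⟩ := exists_lift_chain c hstep
  have hzK : ∀ n, cov (z n) ∈ limitSet M α := fun n => by rw [hz]; exact hcK n
  set t := twos α (l + k)
  have h2t : (1 : ℝ) ≤ 2 ^ t := one_le_pow₀ (by norm_num)
  obtain ⟨n₁, n₂, h12, h2N, j₁, j₂, e1, e2⟩ := exists_crooked_indices hM (m := m) (N₁ + N₂)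
    (X := fun n j => (orbL M α (l + k + j) (z n)).1)
    (Y := fun n j => (orbL M α (l + k + j) (z n)).2) (Λ := 2 * Real.pi * 2 ^ t)
    (fun n => isWiggleOrbit_of_one_run hM1 h1 (hzK n))
    (fun n j hj => by
      rw [← Real.dist_eq, dist_comm]
      refine (le_max_left _ (dist (orbL M α (l + k + j) (z n)).2
        (orbL M α (l + k + j) (z (n + 1))).2)).trans ?_
      rw [← Prod.dist_eq]
      refine (dist_orbL_le hM1 _ _ _).trans ?_
      have : (9 * M) ^ (l + k + j) ≤ (9 * M) ^ (l + k + m) :=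
        pow_le_pow_right₀ (by linarith) (by omega)
      calc (9 * M) ^ (l + k + j) * dist (z n) (z (n + 1))
          ≤ (9 * M) ^ (l + k + m) * δ :=
            mul_le_mul this (hzd n).le dist_nonneg hpow.le
        _ = 0.01 := by rw [hδ]; field_simp)
    (by nlinarith [Real.pi_gt_three])
    (by
      have : (2 : ℝ) ^ t ≤ 2 ^ (l + k) := pow_le_pow_right₀ (by norm_num) (twos_le _ _)
      have hpi := Real.pi_pos
      rw [hm]; push_cast
      nlinarith)
  simp only [add_zero] at e1 e2
  -- points that are close at level `l + k`, up to the period, are close in the limit set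
  have hnear : ∀ (a b : ℕ) (j : ℤ), |(orbL M α (l + k) (z a)).1 -
      ((orbL M α (l + k) (z b)).1 + j * (2 * Real.pi * 2 ^ t))| ≤ 64 →
      dist (c a) (c b) < 1 / (N + 1) := by
    intro a b j h
    have hcov : cov ((z b).1 + 2 * Real.pi * j, (z b).2) = c b := by
      rw [← hz b, cov, cov, angle_coe_add_mul]
    have hd := dist_le_of_zero_run hM1 h0 (hzK a)
      (q := ((z b).1 + 2 * Real.pi * j, (z b).2)) (by rw [hcov]; exact hcK b) (by
        rw [orbL_shift]
        convert h using 3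
        ring)
    rw [← hz a, ← hcov]
    refine (dist_cov_le _ _).trans_lt (hd.trans_lt ?_)
    have hk' : (64 : ℝ) * 8 ^ l * (N + 1) < 2 ^ k := by exact_mod_cast hk
    rw [← mul_div_assoc, div_lt_div_iff₀ (by positivity) (by positivity)]
    linarith
  have f1 := hnear n₁ (N₁ + N₂) j₁ e1
  have f2 := hnear n₂ 0 j₂ e2
  rw [hcQ' _ (Nat.le_add_right _ _), Nat.add_sub_cancel_left, b2] at f1
  rw [show c 0 = p by simp [hc, a1]] at f2
  rcases le_total n₁ N₁ with h | h
  · exact Or.inl ⟨_, hcP _ h, f1⟩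
  · exact Or.inr ⟨_, hcQ _ (h.trans h12), f2⟩

lemma isHereditarilyIndecomposable_limitSet (hM : 2 ^ 9 ≤ M) (hα : ∀ N, HasLongRuns α N) :
    IsHereditarilyIndecomposable (limitSet M α) := by
  refine ⟨⟨isCompact_limitSet hM, isConnected_limitSet hM⟩, ?_⟩
  rintro L hL hLK ⟨P, Q, hP, hQ, hPL, hQL, hPQ⟩
  obtain ⟨q, hqL, hqP⟩ := exists_of_ssubset hPL
  obtain ⟨p, hpL, hpQ⟩ := exists_of_ssubset hQL
  have hq : q ∈ Q := by rw [← hPQ] at hqL; exact hqL.resolve_left hqP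
  have hp : p ∈ P := by rw [← hPQ] at hpL; exact hpL.resolve_right hpQ
  have hne : (P ∩ Q).Nonempty := by
    have := (isPreconnected_closed_iff.1 hL.2.isPreconnected) P Q hP.1.isClosed hQ.1.isClosed
      hPQ.ge ⟨p, hpL, hp⟩ ⟨q, hqL, hq⟩
    exact this.mono inter_subset_right
  obtain ⟨ε₁, h1, hε1⟩ := Metric.isOpen_iff.1 hP.1.isClosed.isOpen_compl q hqP
  obtain ⟨ε₂, h2, hε2⟩ := Metric.isOpen_iff.1 hQ.1.isClosed.isOpen_compl p hpQ
  obtain ⟨N, hN⟩ := exists_nat_one_div_lt (lt_min h1 h2)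
  rcases exists_dist_lt_of_hasLongRuns hM (hα N) hP.2.isPreconnected hQ.2.isPreconnected
    (hPL.1.trans hLK) (hQL.1.trans hLK) hne hp hq with ⟨x, hx, hd⟩ | ⟨x, hx, hd⟩
  · exact hε1 (Metric.mem_ball.2 (hd.trans (hN.trans_le (min_le_left _ _)))) hx
  · exact hε2 (Metric.mem_ball.2 (hd.trans (hN.trans_le (min_le_right _ _)))) hx

/-! ### Circlelikeness -/

/-- An angular coordinate on the annulus whose lift is the first coordinate at level `n`, rescaled
to degree one. -/
noncomputable def theta (M : ℝ) (α : ℕ → Fin 2) : ℕ → S1 × ℝ → S1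
  | 0, p => p.1
  | n + 1, p => if α n = 0 then theta M α n p
      else theta M α n p - ((2 * Real.pi * (orb M α n p).2 / 2 ^ twos α n : ℝ) : S1)

lemma continuous_theta (n : ℕ) : Continuous (theta M α n) := by
  induction n with
  | zero => exact continuous_fst
  | succ n ih =>
    by_cases h : α n = 0
    · simpa only [theta, h, if_true] using ih
    · simp only [theta, h, if_false]
      refine ih.sub (Real.Angle.continuous_coe.comp ?_)
      have := (continuous_orb (M := M) (α := α) n).snd
      fun_prop

lemma theta_cov (n : ℕ) (p : ℝ × ℝ) :
    theta M α n (cov p) = (((orbL M α n p).1 / 2 ^ twos α n : ℝ) : S1) := by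
  induction n with
  | zero => simp [theta, orbL, twos, cov]
  | succ n ih =>
    rw [theta, ih, orbL, twos, orb_cov]
    by_cases h : α n = 0
    · simp only [h, if_true, fibL]
      congr 1; rw [pow_succ]; field_simp
    · simp only [h, if_false, fibL, add_zero, cov, ← Real.Angle.coe_sub, sub_div]

lemma isCirclelike_limitSet (hM : 2 ^ 9 ≤ M) (hα : ∀ N, HasLongRuns α N) :
    IsCirclelike (limitSet M α) := by
  intro ε hε
  have hM1 : 1 ≤ M := by linarith
  obtain ⟨N, hN⟩ := exists_nat_one_div_lt hε
  obtain ⟨l, k, h0, -, hk⟩ := hα N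
  refine ⟨theta M α (l + k), (continuous_theta _).continuousOn, fun w => ?_⟩
  have hk' : (64 : ℝ) * 8 ^ l * (N + 1) < 2 ^ k := by exact_mod_cast hk
  have hlt : (8 : ℝ) ^ l * (64 / 2 ^ k) < ε := by
    refine lt_trans ?_ hN
    rw [← mul_div_assoc, div_lt_div_iff₀ (by positivity) (by positivity)]
    linarith
  refine (Metric.diam_le_of_forall_dist_le (by positivity) ?_).trans_lt hlt
  rintro u ⟨hu, hu'⟩ v ⟨hv, hv'⟩
  obtain ⟨p, rfl⟩ := exists_cov_eq u
  obtain ⟨q, rfl⟩ := exists_cov_eq v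
  have hpq : theta M α (l + k) (cov p) = theta M α (l + k) (cov q) := by
    rw [mem_preimage, mem_singleton_iff] at hu' hv'
    rw [hu', hv']
  rw [theta_cov, theta_cov, Real.Angle.angle_eq_iff_two_pi_dvd_sub] at hpq
  obtain ⟨j, hj⟩ := hpq
  have hcov : cov (q.1 + 2 * Real.pi * j, q.2) = cov q := by
    rw [cov, cov, angle_coe_add_mul]
  rw [← hcov]
  refine (dist_cov_le _ _).trans (dist_le_of_zero_run hM1 h0 hu (by rwa [hcov]) ?_)
  rw [orbL_shift]
  have : (orbL M α (l + k) p).1 = (orbL M α (l + k) q).1 +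
      2 * Real.pi * 2 ^ twos α (l + k) * j := by
    have h2 : (0 : ℝ) < 2 ^ twos α (l + k) := by positivity
    rw [← sub_div, div_eq_iff h2.ne'] at hj
    linarith
  rw [this]
  simp

end HI

/-! ### The limit sets are not arclike -/

/-- On an arclike compactum the angular coordinate has a real lift, continuous up to a bounded
error: the lift is built along the interval, which is cut into bins with preimages of small
diameter. -/
lemma exists_angle_lift_of_isArclike {K : Set (S1 × ℝ)} (hK : IsCompact K) (h : IsArclike K) :
    ∃ φ : S1 × ℝ → ℝ, (∀ u, (φ u : S1) = u.1) ∧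
      ∃ δ > 0, ∀ u ∈ K, ∀ v ∈ K, dist u v < δ → |φ u - φ v| < 1 := by
  classical
  obtain ⟨f, hf, hmaps, hdiam⟩ := h 0.1 (by norm_num)
  have hfib : ∀ u ∈ K, ∀ v ∈ K, f u = f v → dist u v < 0.1 := fun u hu v hv huv =>
    (Metric.dist_le_diam_of_mem (hK.isBounded.subset inter_subset_left)
      (show u ∈ K ∩ f ⁻¹' {f v} from ⟨hu, huv⟩) ⟨hv, rfl⟩).trans_lt (hdiam _)
  -- by compactness, points with close values are close
  obtain ⟨η, hη, hηf⟩ : ∃ η > 0, ∀ u ∈ K, ∀ v ∈ K, |f u - f v| < η → dist u v < 0.1 := by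
    set C : Set ((S1 × ℝ) × (S1 × ℝ)) := (K ×ˢ K) ∩ {w | 0.1 ≤ dist w.1 w.2} with hC
    have hCc : IsCompact C :=
      (hK.prod hK).inter_right (isClosed_le continuous_const continuous_dist)
    rcases C.eq_empty_or_nonempty with he | hne
    · refine ⟨1, one_pos, fun u hu v hv _ => ?_⟩
      by_contra hcon
      exact (eq_empty_iff_forall_notMem.1 he) (u, v) ⟨⟨hu, hv⟩, not_lt.1 hcon⟩
    · have hcont : ContinuousOn (fun w : (S1 × ℝ) × (S1 × ℝ) => |f w.1 - f w.2|) C :=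
        ((hf.comp continuousOn_fst fun w hw => hw.1.1).sub
          (hf.comp continuousOn_snd fun w hw => hw.1.2)).abs
      obtain ⟨w, hw, hmin⟩ := hCc.exists_isMinOn hne hcont
      refine ⟨|f w.1 - f w.2|, ?_, fun u hu v hv huv => ?_⟩
      · rw [gt_iff_lt, abs_pos, sub_ne_zero]
        intro he
        exact absurd (hfib _ hw.1.1 _ hw.1.2 he) (not_lt.2 hw.2)
      · by_contra hcon
        exact absurd (hmin (show (u, v) ∈ C from ⟨⟨hu, hv⟩, not_lt.1 hcon⟩)) (not_le.2 huv)
  obtain ⟨δ, hδ, hδf⟩ := Metric.uniformContinuousOn_iff.1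
    (hK.uniformContinuousOn_of_continuous hf) (η / 3) (by positivity)
  -- `β u` is the bin of `f u`, and `rep j` a point of `K` in the bin `j`, if there is one
  set β : S1 × ℝ → ℕ := fun u => ⌊f u / (η / 3)⌋₊ with hβ
  have hβ1 : ∀ u ∈ K, β u * (η / 3) ≤ f u ∧ f u < (β u + 1) * (η / 3) := fun u hu => by
    have h0 : 0 ≤ f u / (η / 3) := div_nonneg (hmaps hu).1 (by positivity)
    exact ⟨(le_div_iff₀ (by positivity)).1 (Nat.floor_le h0),
      (div_lt_iff₀ (by positivity)).1 (Nat.lt_floor_add_one _)⟩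
  have hβ2 : ∀ u ∈ K, ∀ v ∈ K, dist u v < δ → β v ≤ β u + 1 := by
    intro u hu v hv huv
    have h1 := (abs_lt.1 (hδf u hu v hv huv)).1
    have h2 := (hβ1 u hu).2
    have h3 := (hβ1 v hv).1
    have h4 : (β v : ℝ) < β u + 2 := by
      by_contra hcon
      have := mul_le_mul_of_nonneg_right (not_lt.1 hcon) (show 0 ≤ η / 3 by positivity)
      linarith
    have : β v < β u + 2 := by exact_mod_cast h4
    omega
  have hβ3 : ∀ u ∈ K, ∀ v ∈ K, β u ≤ β v → β v ≤ β u + 1 → dist u v < 0.1 := by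
    intro u hu v hv h1 h2
    apply hηf u hu v hv
    have h1' : (β u : ℝ) ≤ β v := by exact_mod_cast h1
    have h2' : (β v : ℝ) ≤ β u + 1 := by exact_mod_cast h2
    have a1 := hβ1 u hu
    have a2 := hβ1 v hv
    have a3 := mul_le_mul_of_nonneg_right h1' (show 0 ≤ η / 3 by positivity)
    have a4 := mul_le_mul_of_nonneg_right h2' (show 0 ≤ η / 3 by positivity)
    rw [abs_lt]; constructor <;> linarith
  set rep : ℕ → S1 × ℝ := fun j => if h : ∃ u ∈ K, β u = j then h.choose else 0 with hrep
  have hrep1 : ∀ u ∈ K, rep (β u) ∈ K ∧ β (rep (β u)) = β u := by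
    intro u hu
    have h : ∃ v ∈ K, β v = β u := ⟨u, hu, rfl⟩
    simp only [hrep, dif_pos h]
    exact h.choose_spec
  obtain ⟨G, hG0, hG⟩ : ∃ G : ℕ → ℝ, G 0 = (rep 0).1.toReal ∧
      ∀ j, G (j + 1) = G j + ((rep (j + 1)).1 - (rep j).1).toReal :=
    ⟨fun j => Nat.rec (rep 0).1.toReal
      (fun j x => x + ((rep (j + 1)).1 - (rep j).1).toReal) j, rfl, fun j => rfl⟩
  have hG1 : ∀ j, (G j : S1) = (rep j).1 := by
    intro j
    induction j with
    | zero => rw [hG0, Real.Angle.coe_toReal]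
    | succ j ih => rw [hG, Real.Angle.coe_add, ih, Real.Angle.coe_toReal]; abel
  have hsmall : ∀ u v : S1 × ℝ, dist u v < 0.1 → |(u.1 - v.1).toReal| < 0.1 := fun u v h => by
    rw [← norm_angle_eq, ← dist_eq_norm]
    exact (le_max_left _ _).trans_lt h
  have hGstep : ∀ u ∈ K, ∀ v ∈ K, β u ≤ β v → β v ≤ β u + 1 → |G (β u) - G (β v)| < 0.1 := by
    intro u hu v hv h1 h2
    rcases h1.eq_or_lt with h | h
    · rw [h]; norm_num
    · have h3 : β v = β u + 1 := by omega
      have h4 := hrep1 u hu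
      have h5 := hrep1 v hv
      rw [h3, hG, ← h3, sub_add_cancel_left, abs_neg]
      apply hsmall
      rw [dist_comm]
      exact hβ3 _ h4.1 _ h5.1 (by omega) (by omega)
  refine ⟨fun u => G (β u) + (u.1 - (rep (β u)).1).toReal, fun u => ?_, δ, hδ, ?_⟩
  · rw [Real.Angle.coe_add, hG1, Real.Angle.coe_toReal]; abel
  · intro u hu v hv huv
    have h1 : |G (β u) - G (β v)| < 0.1 := by
      rcases le_total (β u) (β v) with h | h
      · exact hGstep u hu v hv h (hβ2 u hu v hv huv)
      · rw [abs_sub_comm]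
        exact hGstep v hv u hu h (hβ2 v hv u hu (by rwa [dist_comm]))
    have h2 : ∀ u ∈ K, |(u.1 - (rep (β u)).1).toReal| < 0.1 := fun u hu =>
      hsmall _ _ (hβ3 _ hu _ (hrep1 u hu).1 (by rw [(hrep1 u hu).2])
        (by rw [(hrep1 u hu).2]; omega))
    have h3 := h2 u hu
    have h4 := h2 v hv
    rw [abs_lt] at h1 h3 h4 ⊢
    constructor <;> linarith

/-- The limit set is surrounded by essential annuli, so it contains closed discrete paths with
arbitrarily small steps that wind once around the cylinder. -/
lemma not_isArclike_limitSet {M : ℝ} {α : ℕ → Fin 2} (hM : 2 ^ 9 ≤ M) :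
    ¬ IsArclike (limitSet M α) := by
  intro harc
  have hK := isCompact_limitSet (α := α) hM
  obtain ⟨φ, hφ, δ, hδ, hφδ⟩ := exists_angle_lift_of_isArclike hK harc
  set δ' := min (δ / 4) 0.1 with hδ'
  have hδ'0 : 0 < δ' := by positivity
  have hδ1 : δ' ≤ δ / 4 := min_le_left _ _
  have hδ2 : δ' ≤ 0.1 := min_le_right _ _
  obtain ⟨n, hn⟩ := exists_subset_nhds_of_isCompact ((level_antitone (α := α) hM).directed_ge)
    (isCompact_level hM) (U := Metric.thickening δ' (limitSet M α)) fun x hx =>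
      Metric.isOpen_thickening.mem_nhds (Metric.self_subset_thickening hδ'0 _ hx)
  have hM1 : 1 ≤ M := by linarith
  obtain ⟨u₀, hu₀⟩ := (isConnected_limitSet (α := α) hM).nonempty
  obtain ⟨p, rfl⟩ := exists_cov_eq u₀
  have hp : cov p ∈ level M α n := mem_iInter.1 hu₀ n
  have hshift : cov (p.1 + 2 * Real.pi * (1 : ℤ), p.2) = cov p := by
    rw [cov, cov, angle_coe_add_mul]
  obtain ⟨N, c, hc0, hcN, hcs, hcd⟩ := exists_isChain
    (isConnected_back_image_strip (α := α) hM1 n).isPreconnected hδ'0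
    ((mem_back_image_strip hM1).2 hp)
    ((mem_back_image_strip hM1).2 (by rw [hshift]; exact hp))
  have hv : ∀ i, ∃ v ∈ limitSet M α, dist (cov (c i)) v < δ' := fun i =>
    Metric.mem_thickening_iff.1 (hn ((mem_back_image_strip hM1).1 (hcs i)))
  choose v hvK hvd using hv
  -- the lift along the path differs from the real coordinate nearly by a multiple of `2π`
  have hψ : ∀ i, ∃ k : ℤ, |φ (v i) - (c i).1 - 2 * Real.pi * k| < 0.1 := by
    intro i
    set θ : S1 := ((φ (v i) - (c i).1 : ℝ) : S1) with hθ
    have h1 : |θ.toReal| < 0.1 := by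
      rw [← norm_angle_eq, hθ, Real.Angle.coe_sub, hφ, ← dist_eq_norm, dist_comm]
      exact ((le_max_left _ _).trans_lt (hvd i)).trans_le hδ2
    obtain ⟨k, hk⟩ := Real.Angle.angle_eq_iff_two_pi_dvd_sub.1
      (show ((φ (v i) - (c i).1 : ℝ) : S1) = ((θ.toReal : ℝ) : S1) by
        rw [Real.Angle.coe_toReal])
    refine ⟨k, ?_⟩
    rwa [← hk, sub_sub_cancel]
  choose k hk using hψ
  have hpi := Real.pi_gt_three
  have hkstep : ∀ i, k (i + 1) = k i := by
    intro i
    have h1 : |φ (v (i + 1)) - φ (v i)| < 1 := by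
      apply hφδ _ (hvK _) _ (hvK _)
      have a1 := dist_triangle4 (v (i + 1)) (cov (c (i + 1))) (cov (c i)) (v i)
      have a2 := hvd i
      have a3 := hvd (i + 1)
      have a4 := (dist_cov_le (c (i + 1)) (c i)).trans_lt (by rw [dist_comm]; exact hcd i)
      rw [dist_comm] at a3
      linarith
    have h2 : |(c (i + 1)).1 - (c i).1| < 0.1 := by
      rw [abs_sub_comm]
      exact ((le_max_left _ _).trans_lt (hcd i)).trans_le hδ2
    have h3 := hk i
    have h4 := hk (i + 1)
    rw [abs_lt] at h1 h2 h3 h4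
    by_contra hne
    rcases lt_or_gt_of_ne hne with h | h
    · have : (k (i + 1) : ℝ) + 1 ≤ k i := by exact_mod_cast h
      nlinarith
    · have : (k i : ℝ) + 1 ≤ k (i + 1) := by exact_mod_cast h
      nlinarith
  have hkN : k N = k 0 := by
    have : ∀ i, k i = k 0 := fun i => by
      induction i with
      | zero => rfl
      | succ i ih => rw [hkstep, ih]
    exact this N
  have h0 := hk 0
  have h1 := hk N
  have h2 : |φ (v N) - φ (v 0)| < 1 := by
    apply hφδ _ (hvK _) _ (hvK _)
    have a1 := dist_triangle (v N) (cov p) (v 0)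
    have a2 := hvd 0
    have a3 := hvd N
    rw [hc0] at a2
    rw [hcN, hshift, dist_comm] at a3
    linarith
  rw [hkN, hcN] at h1
  rw [hc0] at h0
  push_cast at h1
  rw [abs_lt] at h0 h1 h2
  linarith

/-! ### Symbolic coding of the base map -/

/-- The interval of `[0, 2π)` that represents the arc with symbol `a`. -/
def arcL (a : Fin 2) : Set ℝ := if a = 0 then Icc 0 (Real.pi / 2)
  else Icc Real.pi (3 * Real.pi / 2)

/-- The number of turns lost when a point of `arc a` is tripled and lands in `arc b`. -/
def wraps (a b : Fin 2) : ℤ := if a = 0 then 0 else if b = 0 then 2 else 1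

lemma arc_eq (a : Fin 2) : arc a = (fun t : ℝ => (t : S1)) '' arcL a := by
  fin_cases a <;> simp [arc, arcL, I₁, I₂]

lemma abs_sub_le_of_mem_arcL {a : Fin 2} {s t : ℝ} (hs : s ∈ arcL a) (ht : t ∈ arcL a) :
    |s - t| ≤ Real.pi / 2 := by
  unfold arcL at hs ht
  rw [abs_le]
  split_ifs at hs ht <;> obtain ⟨h1, h2⟩ := hs <;> obtain ⟨h3, h4⟩ := ht <;>
    constructor <;> linarith

lemma isCompact_arc (a : Fin 2) : IsCompact (arc a) := by
  rw [arc_eq]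
  refine IsCompact.image ?_ Real.Angle.continuous_coe
  unfold arcL
  split_ifs <;> exact isCompact_Icc

lemma arc_zero : arc 0 = I₁ := rfl

lemma arc_one : arc 1 = I₂ := rfl

lemma mem_union_iff {z : S1} : z ∈ I₁ ∪ I₂ ↔ ∃ a, z ∈ arc a := by
  rw [Fin.exists_fin_two, arc_zero, arc_one, mem_union]

lemma eq_of_mem_arc {a b : Fin 2} {z : S1} (ha : z ∈ arc a) (hb : z ∈ arc b) : a = b := by
  have key : ∀ z : S1, z ∈ arc 0 → z ∉ arc 1 := by
    rintro z h0 h1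
    rw [arc_eq] at h0 h1
    obtain ⟨s, ⟨hs1, hs2⟩, rfl⟩ := h0
    obtain ⟨t, ⟨ht1, ht2⟩, hst⟩ := h1
    obtain ⟨k, hk⟩ := Real.Angle.angle_eq_iff_two_pi_dvd_sub.1 hst
    have hpi := Real.pi_pos
    have k1 : (0 : ℝ) < k := by
      by_contra hcon
      have := not_lt.1 hcon
      nlinarith
    have k2 : (k : ℝ) < 1 := by
      by_contra hcon
      have := not_lt.1 hcon
      nlinarith
    have k1' : 0 < k := by exact_mod_cast k1
    have k2' : k < 1 := by exact_mod_cast k2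
    omega
  fin_cases a <;> fin_cases b
  · rfl
  · exact (key z ha hb).elim
  · exact (key z hb ha).elim
  · rfl

lemma three_mul_eq {a b : Fin 2} {t s : ℝ} (ht : t ∈ arcL a) (hs : s ∈ arcL b)
    (h : mapG (t : S1) = (s : S1)) : 3 * t = s + 2 * Real.pi * wraps a b := by
  rw [mapG, ← Real.Angle.coe_nsmul, Real.Angle.angle_eq_iff_two_pi_dvd_sub] at h
  obtain ⟨k, hk⟩ := h
  have hpi := Real.pi_pos
  simp only [nsmul_eq_mul, Nat.cast_ofNat] at hk
  suffices hw : k = wraps a b by rw [← hw]; linarith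
  have hkey : ∀ c : ℤ, (c : ℝ) - 1 < k → (k : ℝ) < c + 1 → k = c := by
    intro c h1 h2
    have h1' : c - 1 < k := by exact_mod_cast h1
    have h2' : k < c + 1 := by exact_mod_cast h2
    omega
  have hkey2 : ∀ c : ℝ, 2 * Real.pi * c < 2 * Real.pi * k → c < k := fun c h =>
    lt_of_mul_lt_mul_left h (by linarith)
  have hkey3 : ∀ c : ℝ, 2 * Real.pi * k < 2 * Real.pi * c → k < c := fun c h =>
    lt_of_mul_lt_mul_left h (by linarith)
  unfold wraps arcL at *
  split_ifs at * <;> apply hkey <;> push_cast <;> first | apply hkey2 | apply hkey3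
  all_goals (rw [← hk]; linarith [ht.1, ht.2, hs.1, hs.2])

lemma exists_mapG_eq (a : Fin 2) {b : Fin 2} {z : S1} (hz : z ∈ arc b) :
    ∃ w ∈ arc a, mapG w = z := by
  rw [arc_eq] at hz
  obtain ⟨s, hs, rfl⟩ := hz
  refine ⟨(((s + 2 * Real.pi * wraps a b) / 3 : ℝ) : S1), ?_, ?_⟩
  · rw [arc_eq]
    refine ⟨_, ?_, rfl⟩
    have hpi := Real.pi_pos
    unfold wraps arcL at *
    split_ifs at * <;> obtain ⟨h1, h2⟩ := hs <;> constructor <;> push_cast <;> linarith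
  · rw [mapG, ← Real.Angle.coe_nsmul, nsmul_eq_mul, Nat.cast_ofNat,
      mul_div_cancel₀ _ (by norm_num), angle_coe_add_mul]

/-- The itinerary determines the point: tripling expands the distance of two points with the same
itinerary, which stays bounded. -/
lemma eq_of_forall_mem_arc {α : ℕ → Fin 2} {z w : S1} (hz : ∀ n, mapG^[n] z ∈ arc (α n))
    (hw : ∀ n, mapG^[n] w ∈ arc (α n)) : z = w := by
  simp only [arc_eq] at hz hw
  choose s hs hs' using hz
  choose t ht ht' using hw
  have hstep : ∀ n, s (n + 1) - t (n + 1) = 3 * (s n - t n) := by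
    intro n
    have h1 := three_mul_eq (hs n) (hs (n + 1)) (by
      have := hs' n; have h2 := hs' (n + 1)
      beta_reduce at this h2
      rw [this, h2, Function.iterate_succ_apply'])
    have h2 := three_mul_eq (ht n) (ht (n + 1)) (by
      have := ht' n; have h2 := ht' (n + 1)
      beta_reduce at this h2
      rw [this, h2, Function.iterate_succ_apply'])
    linarith
  have hpow : ∀ n, s n - t n = 3 ^ n * (s 0 - t 0) := by
    intro n
    induction n with
    | zero => simp
    | succ n ih => rw [hstep, ih, pow_succ]; ring
  have h0 : s 0 - t 0 = 0 := by
    by_contra hne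
    have hpos : 0 < |s 0 - t 0| := abs_pos.2 hne
    obtain ⟨n, hn⟩ := pow_unbounded_of_one_lt (Real.pi / 2 / |s 0 - t 0|)
      (show (1 : ℝ) < 3 by norm_num)
    rw [div_lt_iff₀ hpos] at hn
    have := abs_sub_le_of_mem_arcL (hs n) (ht n)
    rw [hpow, abs_mul, abs_of_pos (by positivity)] at this
    linarith
  have h1 := hs' 0
  have h2 := ht' 0
  simp only [Function.iterate_zero, id] at h1 h2
  rw [← h1, ← h2, sub_eq_zero.1 h0]

lemma continuous_mapG_iterate (n : ℕ) : Continuous mapG^[n] := by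
  refine Continuous.iterate ?_ n
  unfold mapG
  fun_prop

lemma exists_forall_mem_arc (α : ℕ → Fin 2) : ∃ z, ∀ n, mapG^[n] z ∈ arc (α n) := by
  have hfin : ∀ (n : ℕ) (α : ℕ → Fin 2), ∃ z, ∀ i ≤ n, mapG^[i] z ∈ arc (α i) := by
    intro n
    induction n with
    | zero =>
      intro α
      obtain ⟨t, ht⟩ : (arcL (α 0)).Nonempty := by
        have := Real.pi_pos
        unfold arcL
        split_ifs <;> rw [nonempty_Icc] <;> linarith
      refine ⟨t, fun i hi => ?_⟩
      rw [Nat.le_zero.1 hi, arc_eq]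
      exact ⟨t, ht, rfl⟩
    | succ n ih =>
      intro α
      obtain ⟨w, hw⟩ := ih fun i => α (i + 1)
      obtain ⟨z, hz, hzw⟩ := exists_mapG_eq (α 0) (hw 0 n.zero_le)
      refine ⟨z, fun i hi => ?_⟩
      rcases i with _ | i
      · exact hz
      · rw [Function.iterate_succ_apply, hzw]
        exact hw i (by omega)
  have hcl : ∀ n, IsClosed {z | ∀ i ≤ n, mapG^[i] z ∈ arc (α i)} := fun n => by
    simp only [ofPred_forall]
    exact isClosed_iInter fun i => isClosed_iInter fun _ =>
      (isCompact_arc _).isClosed.preimage (continuous_mapG_iterate i)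
  obtain ⟨z, hz⟩ := IsCompact.nonempty_iInter_of_sequence_nonempty_isCompact_isClosed
    (fun n => {z | ∀ i ≤ n, mapG^[i] z ∈ arc (α i)})
    (fun n z hz i hi => hz i (hi.trans n.le_succ)) (fun n => hfin n α) (hcl 0).isCompact hcl
  exact ⟨z, fun n => mem_iInter.1 hz n n le_rfl⟩

lemma mem_cantorC_of_forall_mem_arc {α : ℕ → Fin 2} {z : S1} (h : ∀ n, mapG^[n] z ∈ arc (α n)) :
    z ∈ cantorC := fun n => mem_union_iff.2 ⟨_, h n⟩

lemma mem_arc_itinerary {z : S1} (hz : z ∈ cantorC) (n : ℕ) : mapG^[n] z ∈ arc (itinerary z n) := by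
  unfold itinerary
  split_ifs with h
  · exact h
  · exact (hz n).resolve_left h

lemma itinerary_eq {α : ℕ → Fin 2} {z : S1} (h : ∀ n, mapG^[n] z ∈ arc (α n)) :
    itinerary z = α :=
  funext fun n => eq_of_mem_arc (mem_arc_itinerary (mem_cantorC_of_forall_mem_arc h) n) (h n)

lemma isCompact_cantorC : IsCompact cantorC := by
  have : cantorC = ⋂ n : ℕ, mapG^[n] ⁻¹' (I₁ ∪ I₂) := by ext z; simp [cantorC]
  rw [this]
  exact (isClosed_iInter fun n => ((isCompact_arc 0).isClosed.union
    (isCompact_arc 1).isClosed).preimage (continuous_mapG_iterate n)).isCompact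

lemma continuous_itinerary : Continuous fun z : cantorC => itinerary z := by
  refine continuous_pi fun n => ?_
  have hpre : ∀ b : Fin 2, IsClosed {z : cantorC | itinerary z n = b} := fun b => by
    have : {z : cantorC | itinerary z n = b} = (fun z : cantorC => mapG^[n] z) ⁻¹' arc b := by
      ext z
      constructor
      · rintro rfl
        exact mem_arc_itinerary z.2 n
      · exact fun h => eq_of_mem_arc (mem_arc_itinerary z.2 n) h
    rw [this]
    exact (isCompact_arc b).isClosed.preimage
      ((continuous_mapG_iterate n).comp continuous_subtype_val)
  refine continuous_discrete_rng.2 fun b => ?_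
  rw [← isClosed_compl_iff]
  convert hpre (1 - b) using 1
  ext z
  have key : ∀ a b : Fin 2, ¬ a = b ↔ a = 1 - b := by decide
  exact key (itinerary z n) b

/-- The coding of `C` by symbol sequences, as a homeomorphism. -/
noncomputable def coding : cantorC ≃ₜ (ℕ → Fin 2) :=
  have : CompactSpace cantorC := isCompact_iff_compactSpace.1 isCompact_cantorC
  Continuous.homeoOfEquivCompactToT2
    (f := Equiv.ofBijective (fun z : cantorC => itinerary z) ⟨fun z w h =>
      Subtype.ext (eq_of_forall_mem_arc (mem_arc_itinerary z.2) (by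
        beta_reduce at h; rw [h]; exact mem_arc_itinerary w.2)), fun α => by
      obtain ⟨z, hz⟩ := exists_forall_mem_arc α
      exact ⟨⟨z, mem_cantorC_of_forall_mem_arc hz⟩, itinerary_eq hz⟩⟩) continuous_itinerary

lemma isCantorSet_cantorC : IsCantorSet cantorC :=
  ⟨coding.trans ((Homeomorph.piCongrRight fun _ => finTwoEquiv.toHomeomorphOfDiscrete).trans
    cantorSetHomeomorphNatToBool.symm)⟩

lemma isTotallyDisconnected_cantorC : IsTotallyDisconnected cantorC := by
  rw [← totallyDisconnectedSpace_subtype_iff]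
  exact coding.symm.totallyDisconnectedSpace

/-! ### The skew product -/

section Skew

variable {M : ℝ} {F : (S1 × ℝ) × S1 → (S1 × ℝ) × S1}

lemma IsSkewProduct.apply (hF : IsSkewProduct M F) {a : Fin 2} {z : S1} (hz : z ∈ arc a)
    (p : S1 × ℝ) : F (p, z) = (fib M a p, mapG z) := by
  fin_cases a
  · exact hF.1 p z hz
  · exact hF.2 p z hz

lemma IsSkewProduct.iterate (hF : IsSkewProduct M F) {α : ℕ → Fin 2} {n : ℕ} {p : S1 × ℝ} {z : S1}
    (h : ∀ i < n, mapG^[i] z ∈ arc (α i)) : F^[n] (p, z) = (orb M α n p, mapG^[n] z) := by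
  induction n with
  | zero => rfl
  | succ n ih =>
    rw [Function.iterate_succ_apply', ih fun i hi => h i (by omega), hF.apply (h n (by omega)),
      orb, Function.iterate_succ_apply']

lemma IsSkewProduct.forall_iterate_mem_iff (hF : IsSkewProduct M F) {α : ℕ → Fin 2} {p : S1 × ℝ}
    {z : S1} : (∀ n, F^[n] (p, z) ∈ annulus ×ˢ arc (α n)) ↔
      (∀ n, mapG^[n] z ∈ arc (α n)) ∧ p ∈ limitSet M α := by
  constructor
  · intro h
    have hz : ∀ n, ∀ i < n, mapG^[i] z ∈ arc (α i) := by
      intro n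
      induction n with
      | zero => simp
      | succ n ih =>
        intro i hi
        rcases (Nat.lt_succ_iff.1 hi).lt_or_eq with h' | rfl
        · exact ih i h'
        · have := (h i).2
          rwa [hF.iterate ih] at this
    refine ⟨fun n => hz (n + 1) n n.lt_succ_self, mem_iInter.2 fun n => ?_⟩
    have := (h n).1
    rwa [hF.iterate (hz n)] at this
  · rintro ⟨hz, hp⟩ n
    rw [hF.iterate fun i _ => hz i]
    exact ⟨mem_iInter.1 hp n, hz n⟩

lemma mem_invariantSet_iff (hF : IsSkewProduct M F) {p : S1 × ℝ} {z : S1} :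
    (p, z) ∈ invariantSet F ↔ z ∈ cantorC ∧ p ∈ limitSet M (itinerary z) := by
  constructor
  · intro h
    have h' : ∀ n, ∃ a, (F^[n] (p, z)).2 ∈ arc a := fun n => mem_union_iff.1 (mem_iInter.1 h n).2
    choose α hα using h'
    obtain ⟨hz, hp⟩ := hF.forall_iterate_mem_iff.1 fun n => ⟨(mem_iInter.1 h n).1, hα n⟩
    rw [itinerary_eq hz]
    exact ⟨mem_cantorC_of_forall_mem_arc hz, hp⟩
  · rintro ⟨hz, hp⟩
    refine mem_iInter.2 fun n => ?_
    have := hF.forall_iterate_mem_iff.2 ⟨mem_arc_itinerary hz, hp⟩ n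
    exact ⟨this.1, mem_union_iff.2 ⟨_, this.2⟩⟩

lemma slice_eq (hF : IsSkewProduct M F) {z : S1} (hz : z ∈ cantorC) :
    slice F z = (fun p => (p, z)) '' limitSet M (itinerary z) := by
  ext ⟨p, w⟩
  simp only [slice, mem_iInter, mem_preimage]
  rw [hF.forall_iterate_mem_iff]
  constructor
  · rintro ⟨hw, hp⟩
    exact ⟨p, hp, by rw [eq_of_forall_mem_arc hw (mem_arc_itinerary hz)]⟩
  · rintro ⟨q, hq, h⟩
    obtain ⟨rfl, rfl⟩ := Prod.mk.inj h
    exact ⟨mem_arc_itinerary hz, hq⟩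

/-- As `F` is continuous only over the arcs, the closed sets of points that stay there for `n` steps
are built up recursively. -/
lemma isClosed_invariantSet (hF : IsSkewProduct M F) : IsClosed (invariantSet F) := by
  set S : Set ((S1 × ℝ) × S1) := annulus ×ˢ (I₁ ∪ I₂) with hS
  have hcl : ∀ a, IsClosed (annulus ×ˢ arc a : Set ((S1 × ℝ) × S1)) := fun a =>
    isCompact_annulus.isClosed.prod (isCompact_arc a).isClosed
  have hSu : S = annulus ×ˢ arc 0 ∪ annulus ×ˢ arc 1 := by rw [hS, prod_union]; rfl
  have hScl : IsClosed S := by rw [hSu]; exact (hcl 0).union (hcl 1)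
  have hcont : ∀ a, ContinuousOn F (annulus ×ˢ arc a) := fun a => by
    refine ContinuousOn.congr (f := fun w => (fib M a w.1, mapG w.2)) ?_
      fun w hw => hF.apply hw.2 w.1
    exact (((continuous_fib a).comp continuous_fst).prodMk
      ((continuous_mapG_iterate 1).comp continuous_snd)).continuousOn
  have hFS : ContinuousOn F S := by
    rw [hSu]; exact (hcont 0).union_of_isClosed (hcont 1) (hcl 0) (hcl 1)
  have hfin : ∀ n : ℕ, IsClosed {w | ∀ i ≤ n, F^[i] w ∈ S} := by
    intro n
    induction n with
    | zero => simpa using hScl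
    | succ n ih =>
      convert hFS.preimage_isClosed_of_isClosed hScl ih using 1
      ext w
      constructor
      · exact fun h => ⟨h 0 (Nat.zero_le _), fun i hi => h (i + 1) (by omega)⟩
      · rintro ⟨h1, h2⟩ (_ | i) hi
        · exact h1
        · exact h2 i (by omega)
  have : invariantSet F = ⋂ n : ℕ, {w | ∀ i ≤ n, F^[i] w ∈ S} := by
    ext w
    simp only [invariantSet, mem_iInter, mem_preimage]
    exact ⟨fun h n i _ => h i, fun h n => h n n le_rfl⟩
  rw [this]
  exact isClosed_iInter hfin

lemma isCompact_invariantSet (hF : IsSkewProduct M F) : IsCompact (invariantSet F) := by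
  refine (isCompact_annulus.prod (isCompact_univ (X := S1))).of_isClosed_subset
    (isClosed_invariantSet hF) fun w hw => ⟨(mem_iInter.1 hw 0).1, mem_univ _⟩

lemma image_invariantSet (hM : 2 ^ 9 ≤ M) (hF : IsSkewProduct M F) :
    F '' invariantSet F = invariantSet F := by
  apply Subset.antisymm
  · rintro _ ⟨w, hw, rfl⟩
    exact mem_iInter.2 fun n => mem_iInter.1 hw (n + 1)
  · rintro ⟨p, z⟩ h
    obtain ⟨a, ha⟩ := mem_union_iff.1 (mem_iInter.1 h 0).2
    obtain ⟨w, hw, rfl⟩ := exists_mapG_eq 0 ha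
    obtain ⟨q, rfl⟩ := exists_cov_eq p
    have hq : fib M 0 (cov (invL M 0 q)) = cov q := by
      rw [fib_cov, fibL_invL (by linarith)]
    have hFw : F (cov (invL M 0 q), w) = (cov q, mapG w) := by rw [hF.apply hw, hq]
    refine ⟨(cov (invL M 0 q), w), mem_iInter.2 fun n => ?_, hFw⟩
    rcases n with _ | n
    · refine ⟨mem_annulus.2 (abs_snd_le_of_fib hM 0 ?_), mem_union_iff.2 ⟨0, hw⟩⟩
      have h0 := mem_annulus.1 (mem_iInter.1 h 0).1
      rw [← hq] at h0
      exact h0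
    · rw [mem_preimage, Function.iterate_succ_apply, hFw]
      exact mem_iInter.1 h n

lemma isComponentOf_slice (hM : 2 ^ 9 ≤ M) (hF : IsSkewProduct M F) {z : S1} (hz : z ∈ cantorC) :
    IsComponentOf (slice F z) (invariantSet F) := by
  obtain ⟨p, hp⟩ := (isConnected_limitSet (α := itinerary z) hM).nonempty
  have hconn : IsPreconnected (slice F z) := by
    rw [slice_eq hF hz]
    exact (isConnected_limitSet hM).isPreconnected.image _ (by fun_prop)
  have hsub : slice F z ⊆ invariantSet F := by
    rw [slice_eq hF hz]
    rintro _ ⟨q, hq, rfl⟩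
    exact (mem_invariantSet_iff hF).2 ⟨hz, hq⟩
  have hpz : (p, z) ∈ slice F z := by rw [slice_eq hF hz]; exact ⟨p, hp, rfl⟩
  refine ⟨(p, z), hsub hpz, Subset.antisymm (hconn.subset_connectedComponentIn hpz hsub) ?_⟩
  rintro ⟨q, w⟩ hq
  have hCsub : Prod.snd '' connectedComponentIn (invariantSet F) (p, z) ⊆ cantorC := by
    rintro _ ⟨⟨q, w⟩, hq, rfl⟩
    exact ((mem_invariantSet_iff hF).1 (connectedComponentIn_subset _ _ hq)).1
  have hwz : w = z := isTotallyDisconnected_cantorC _ hCsub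
    (isPreconnected_connectedComponentIn.image _ continuous_snd.continuousOn)
    ⟨_, hq, rfl⟩ ⟨_, mem_connectedComponentIn (hsub hpz), rfl⟩
  subst hwz
  rw [slice_eq hF hz]
  exact ⟨q, ((mem_invariantSet_iff hF).1 (connectedComponentIn_subset _ _ hq)).2, rfl⟩

end Skew

/-! ### Pseudocircles -/

/-- Pseudocircles are carried to pseudocircles by isometric embeddings that have a continuous
left inverse. -/
lemma IsPseudocircle.image {E E' : Type*} [MetricSpace E] [MetricSpace E'] {K : Set E}
    (hK : IsPseudocircle K) {ι : E → E'} (hι : Isometry ι) {π : E' → E} (hπ : Continuous π)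
    (hπι : ∀ x, π (ι x) = x) : IsPseudocircle (ι '' K) := by
  obtain ⟨⟨hc, hconn⟩, ⟨-, hind⟩, hcirc, harc⟩ := hK
  have hcont : IsContinuum (ι '' K) :=
    ⟨hc.image hι.continuous, hconn.image _ hι.continuous.continuousOn⟩
  have himg : ∀ {P}, IsContinuum P → IsContinuum (π '' P) := fun hP =>
    ⟨hP.1.image hπ, hP.2.image _ hπ.continuousOn⟩
  refine ⟨hcont, ⟨hcont, ?_⟩, ?_, ?_⟩
  · rintro L hL hLK ⟨P, Q, hP, hQ, hPL, hQL, hPQ⟩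
    have hinj : InjOn π (ι '' K) := by
      rintro _ ⟨x, -, rfl⟩ _ ⟨y, -, rfl⟩ h
      rw [hπι, hπι] at h; rw [h]
    have hLK' : π '' L ⊆ K := by
      rintro _ ⟨w, hw, rfl⟩
      obtain ⟨x, hx, rfl⟩ := hLK hw
      rwa [hπι]
    have hss : ∀ {P}, P ⊂ L → π '' P ⊂ π '' L := fun {P} h => by
      obtain ⟨w, hw, hwP⟩ := exists_of_ssubset h
      refine (ssubset_iff_of_subset (image_mono h.1)).2 ⟨π w, ⟨w, hw, rfl⟩, ?_⟩
      rintro ⟨v, hv, hvw⟩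
      exact hwP (hinj (hLK (h.1 hv)) (hLK hw) hvw ▸ hv)
    exact hind _ (himg hL) hLK' ⟨π '' P, π '' Q, himg hP, himg hQ, hss hPL, hss hQL,
      by rw [← image_union, hPQ]⟩
  · intro ε hε
    obtain ⟨f, hf, hd⟩ := hcirc ε hε
    refine ⟨f ∘ π, hf.comp hπ.continuousOn ?_, fun z => ?_⟩
    · rintro _ ⟨x, hx, rfl⟩
      rwa [hπι]
    · have hdz := hd z
      rw [← hι.diam_image] at hdz
      convert hdz using 2
      ext w
      constructor
      · rintro ⟨⟨x, hx, rfl⟩, hw⟩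
        rw [mem_preimage, Function.comp_apply, hπι] at hw
        exact ⟨x, ⟨hx, hw⟩, rfl⟩
      · rintro ⟨x, ⟨hx, hw⟩, rfl⟩
        exact ⟨⟨x, hx, rfl⟩, by rwa [mem_preimage, Function.comp_apply, hπι]⟩
  · intro h
    apply harc
    intro ε hε
    obtain ⟨f, hf, hm, hd⟩ := h ε hε
    refine ⟨f ∘ ι, hf.comp hι.continuous.continuousOn fun x hx => ⟨x, hx, rfl⟩,
      fun x hx => hm ⟨x, hx, rfl⟩, fun t => ?_⟩
    rw [← hι.diam_image]
    convert hd t using 2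
    ext w
    constructor
    · rintro ⟨x, ⟨hx, hw⟩, rfl⟩
      exact ⟨⟨x, hx, rfl⟩, hw⟩
    · rintro ⟨⟨x, hx, rfl⟩, hw⟩
      exact ⟨x, ⟨hx, hw⟩, rfl⟩

lemma isPseudocircle_limitSet {M : ℝ} {α : ℕ → Fin 2} (hM : 2 ^ 9 ≤ M)
    (hα : ∀ N, HasLongRuns α N) : IsPseudocircle (limitSet M α) :=
  ⟨⟨isCompact_limitSet hM, isConnected_limitSet hM⟩, isHereditarilyIndecomposable_limitSet hM hα,
    isCirclelike_limitSet hM hα, not_isArclike_limitSet hM⟩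

/-! ### Genericity of long runs -/

lemma isOpen_hasLongRuns (N : ℕ) : IsOpen {α | HasLongRuns α N} := by
  have hcoord : ∀ (j : ℕ) (a : Fin 2), IsOpen {α : ℕ → Fin 2 | α j = a} := fun j a => by
    have : {α : ℕ → Fin 2 | α j = a} = (fun α => α j) ⁻¹' {a} := rfl
    rw [this]
    exact (isOpen_discrete _).preimage (continuous_apply j)
  have hrun : ∀ (s m : ℕ) (a : Fin 2), IsOpen {α : ℕ → Fin 2 | ∀ i < m, α (s + i) = a} :=
    fun s m a => by
      have : {α : ℕ → Fin 2 | ∀ i < m, α (s + i) = a} =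
          ⋂ i ∈ Iio m, {α : ℕ → Fin 2 | α (s + i) = a} := by ext; simp
      rw [this]
      exact (finite_Iio m).isOpen_biInter fun i _ => hcoord _ a
  have : {α | HasLongRuns α N} = ⋃ (l : ℕ) (k : ℕ), {α : ℕ → Fin 2 | ∀ i < k, α (l + i) = 0} ∩
      {α | ∀ i < 2 ^ (l + k), α (l + k + i) = 1} ∩
      {_α | 64 * 8 ^ l * (N + 1) < 2 ^ k} := by
    ext α; simp [HasLongRuns, and_assoc]
  rw [this]
  exact isOpen_iUnion fun l => isOpen_iUnion fun k =>
    ((hrun l k 0).inter (hrun (l + k) _ 1)).inter isOpen_const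

/-- Long runs may be inserted behind any prefix. -/
lemma dense_hasLongRuns (N : ℕ) : Dense {α | HasLongRuns α N} := by
  intro α
  set k : ℕ → ℕ := fun l => 64 * 8 ^ l * (N + 1)
  -- insert the runs behind the first `l` symbols of `α`
  refine mem_closure_of_tendsto (b := Filter.atTop)
    (f := fun l i => if i < l then α i else if i < l + k l then 0 else 1) ?_
    (Filter.Eventually.of_forall fun l => ⟨l, k l, fun i hi => ?_, fun i _ => ?_,
      Nat.lt_two_pow_self⟩)
  · refine tendsto_pi_nhds.2 fun i => tendsto_const_nhds.congr' ?_
    filter_upwards [Filter.eventually_gt_atTop i] with l hl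
    rw [if_pos hl]
  · beta_reduce
    rw [if_neg (by omega), if_pos (by omega)]
  · beta_reduce
    rw [if_neg (by omega), if_neg (by omega)]

end SkewPseudocircle

theorem mainTheorem2 (M : ℝ) (hM : 2 ^ 9 ≤ M) (F : (S1 × ℝ) × S1 → (S1 × ℝ) × S1)
    (hF : IsSkewProduct M F) :
    -- the set is compact and invariant
    IsCompact (invariantSet F) ∧ F '' invariantSet F = invariantSet F ∧
    -- its projection to the third factor is the Cantor set `C`, coded by symbol sequences
    IsCantorSet cantorC ∧ Prod.snd '' invariantSet F = cantorC ∧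
    (∀ z ∈ cantorC, ∃! α : ℕ → Fin 2, ∀ n, mapG^[n] z ∈ arc (α n)) ∧
    (∀ α : ℕ → Fin 2, ∃ z ∈ cantorC, ⋂ n : ℕ, mapG^[n] ⁻¹' arc (α n) = {z}) ∧
    -- each slice is a nonempty connected component, lying over its base point
    (∀ z ∈ cantorC, (slice F z).Nonempty ∧ IsComponentOf (slice F z) (invariantSet F) ∧
      Prod.snd '' slice F z = {z}) ∧
    -- for a dense Gδ set of points of `C` the slice is a pseudocircle
    (∃ G : Set cantorC, IsGδ G ∧ Dense G ∧
      ∀ z ∈ G, IsPseudocircle (slice F (z : S1))) := by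
  have hne : ∀ α, (limitSet M α).Nonempty := fun α => (isConnected_limitSet hM).nonempty
  refine ⟨isCompact_invariantSet hF, image_invariantSet hM hF, isCantorSet_cantorC, ?_,
    fun z hz => ⟨itinerary z, mem_arc_itinerary hz, fun β hβ => (itinerary_eq hβ).symm⟩, ?_, ?_, ?_⟩
  · ext z
    constructor
    · rintro ⟨⟨p, w⟩, h, rfl⟩
      exact ((mem_invariantSet_iff hF).1 h).1
    · intro hz
      obtain ⟨p, hp⟩ := hne (itinerary z)
      exact ⟨(p, z), (mem_invariantSet_iff hF).2 ⟨hz, hp⟩, rfl⟩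
  · intro α
    obtain ⟨z, hz⟩ := exists_forall_mem_arc α
    refine ⟨z, mem_cantorC_of_forall_mem_arc hz, ?_⟩
    ext w
    rw [mem_iInter, mem_singleton_iff]
    exact ⟨fun h => eq_of_forall_mem_arc h hz, fun h n => h ▸ hz n⟩
  · intro z hz
    refine ⟨?_, isComponentOf_slice hM hF hz, ?_⟩
    · rw [slice_eq hF hz]
      exact (hne _).image _
    · rw [slice_eq hF hz, image_image]
      exact (hne _).image_const z
  · refine ⟨coding ⁻¹' ⋂ N, {α | HasLongRuns α N},
      (IsGδ.iInter_of_isOpen isOpen_hasLongRuns).preimage coding.continuous,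
      (dense_iInter_of_isOpen isOpen_hasLongRuns dense_hasLongRuns).preimage coding.isOpenMap,
      fun z hz => ?_⟩
    rw [slice_eq hF z.2]
    refine IsPseudocircle.image (isPseudocircle_limitSet hM fun N => ?_)
      (Isometry.of_dist_eq fun p q => ?_) continuous_fst fun _ => rfl
    · exact mem_iInter.1 hz N
    · simp [Prod.dist_eq]
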